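/- Let $(M,g)$ be a nonempty smooth Riemannian manifold of dimension $n\ge 2$ and let $T^*M$ be the total space of its cotangent bundle. For $p\in T^*_xM$ put $t=\tfrac12 g^{-1}(p,p)$, and let $X^H$, $\alpha^V$ denote the horizontal lift at $p$ of $X\in T_xM$ (with respect to the Levi-Civita connection of $g$) and the vertical lift at $p$ of $\alpha\in T^*_xM$. Let $a_1,a_2,b_1,b_2,c_1,c_2,d_1,d_2$ be real functions, smooth on $[0,\infty)$, and let the $(1,1)$-tensor field $P$ and the symmetric $(0,2)$-tensor field $G$ on $T^*M$ (the natural diagonal lifts) be given at $p$ by $$PX^H=a_1(t)(X^\flat)^V+b_1(t)\,p(X)\,p^V,\qquad P\alpha^V=a_2(t)(\alpha^\sharp)^H+b_2(t)\,g^{-1}(p,\alpha)(p^\sharp)^H,$$ $$G(X^H,Y^H)=c_1(t)g(X,Y)+d_1(t)p(X)p(Y),\qquad G(\alpha^V,\beta^V)=c_2(t)g^{-1}(\alpha,\beta)+d_2(t)g^{-1}(p,\alpha)g^{-1}(p,\beta),\qquad G(X^H,\alpha^V)=0.$$ Suppose that $(G,P)$ is an almost para-Hermitian structure on $T^*M$,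 i.e. $P^2=\mathrm{id}$, $G$ is nondegenerate, and $G(PZ,PW)=-G(Z,W)$ for all tangent vectors $Z,W$. Then there are real functions $\lambda,\mu$, smooth on $[0,\infty)$, such that for all $t\ge 0$ $$\frac{c_1}{a_1}=-\frac{c_2}{a_2}=\lambda,\qquad \frac{c_1+2td_1}{a_1+2tb_1}=-\frac{c_2+2td_2}{a_2+2tb_2}=\lambda+2t\mu ,$$ and, for any such $\lambda,\mu$, the fundamental $2$-form $\Omega(Z,W)=G(Z,PW)$ is closed, $d\Omega=0$ on $T^*M$ (that is, $(G,P)$ is almost para-Kählerian), if and only if $\mu(t)=\lambda'(t)$ for all $t\ge 0$ (with $\lambda'(0)$ the one-sided derivative). -/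

import Mathlib

open Bundle Set
open scoped Manifold ContDiff

noncomputable section

namespace NaturalDiagonal

/-! ### The cotangent bundle -/

/-- The total space `T^*M` of the cotangent bundle of `M`, with Mathlib's topology and smooth
structure: the chart of `T^*M` around `p ∈ T^*_x M` is the chart `(q, p)` induced by the preferred
chart of `M` at `x`. -/
abbrev CotangentBundle (E : Type*) [NormedAddCommGroup E] [NormedSpace ℝ E]
    (M : Type*) [TopologicalSpace M] [ChartedSpace E M] [IsManifold 𝓘(ℝ, E) ∞ M] :=
  TotalSpace (E →L[ℝ] ℝ) (fun x : M => TangentSpace 𝓘(ℝ, E) x →L[ℝ] ℝ)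

/-- The model with corners (without boundary) of `T^*M`. -/
abbrev cotModel (E : Type*) [NormedAddCommGroup E] [NormedSpace ℝ E] :=
  𝓘(ℝ, E).prod 𝓘(ℝ, E →L[ℝ] ℝ)

/-! ### Differential forms on a manifold -/

section Forms

variable {F : Type*} [NormedAddCommGroup F] [NormedSpace ℝ F]
  {H : Type*} [TopologicalSpace H] (I : ModelWithCorners ℝ F H)
  {N : Type*} [TopologicalSpace N] [ChartedSpace H N]

/-- The local expression of a differential `k`-form `θ` on a manifold `N` in the preferred chart
around `x`, i.e. the pullback of `θ` under the inverse of that chart. -/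
def formInChart {k : ℕ} (θ : ∀ x : N, TangentSpace I x [⋀^Fin k]→L[ℝ] ℝ) (x : N) (y : F) :
    F [⋀^Fin k]→L[ℝ] ℝ :=
  (θ ((extChartAt I x).symm y)).compContinuousLinearMap
    (mfderivWithin 𝓘(ℝ, F) I (extChartAt I x).symm (range I) y)

/-- The exterior derivative `dθ` of a differential `k`-form `θ` on a manifold, computed at `x`
in the preferred chart around `x` (whose derivative at `x` is the identity of `T_x N`). -/
def extDerivManifold {k : ℕ} (θ : ∀ x : N, TangentSpace I x [⋀^Fin k]→L[ℝ] ℝ) (x : N) :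
    TangentSpace I x [⋀^Fin (k + 1)]→L[ℝ] ℝ :=
  (extDerivWithin (formInChart I θ x) (range I) (extChartAt I x x) : F [⋀^Fin (k + 1)]→L[ℝ] ℝ)

end Forms

/-! ### Almost para-Hermitian structures -/

section ParaHermitian

variable {F : Type*} [NormedAddCommGroup F] [NormedSpace ℝ F] [FiniteDimensional ℝ F]
  {H : Type*} [TopologicalSpace H] {I : ModelWithCorners ℝ F H}
  {N : Type*} [TopologicalSpace N] [ChartedSpace H N]

/-- `(G, P)` is an almost para-Hermitian structure: `P² = id`, `G` is a (pseudo-Riemannian, i.e.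
symmetric and nondegenerate) metric, and `G(PX, PY) = -G(X, Y)`. -/
structure IsAlmostParaHermitian
    (G : ∀ x : N, TangentSpace I x →ₗ[ℝ] TangentSpace I x →ₗ[ℝ] ℝ)
    (P : ∀ x : N, TangentSpace I x →ₗ[ℝ] TangentSpace I x) : Prop where
  symm : ∀ x X Y, G x X Y = G x Y X
  nondegenerate : ∀ x X, (∀ Y, G x X Y = 0) → X = 0
  sq_eq_id : ∀ x X, P x (P x X) = X
  compat : ∀ x X Y, G x (P x X) (P x Y) = - G x X Y

/-- The fundamental `2`-form `Ω(X, Y) = G(X, PY)` of an almost para-Hermitian structure. -/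
def fundamentalForm {G : ∀ x : N, TangentSpace I x →ₗ[ℝ] TangentSpace I x →ₗ[ℝ] ℝ}
    {P : ∀ x : N, TangentSpace I x →ₗ[ℝ] TangentSpace I x}
    (h : IsAlmostParaHermitian G P) (x : N) : TangentSpace I x [⋀^Fin 2]→L[ℝ] ℝ where
  toFun v := G x (v 0) (P x (v 1))
  map_update_add' v i X Y := by
    fin_cases i <;> simp
  map_update_smul' v i c X := by
    fin_cases i <;> simp
  map_eq_zero_of_eq' v i j hij hne := by
    have key : ∀ X, G x X (P x X) = 0 := by
      intro X
      have h1 := h.compat x X (P x X)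
      rw [h.sq_eq_id, h.symm] at h1
      linarith
    have h01 : v 0 = v 1 := by
      fin_cases i <;> fin_cases j <;> simp_all
    rw [h01]
    exact key _
  cont := by
    let B : F →ₗ[ℝ] F →ₗ[ℝ] ℝ := (G x).compl₂ (P x)
    have hB : Continuous fun q : F × F => B q.1 q.2 :=
      (B.toContinuousBilinearMap).continuous₂
    have hv : Continuous fun v : Fin 2 → F => (v 0, v 1) :=
      (continuous_apply 0).prodMk (continuous_apply 1)
    exact hB.comp hv

end ParaHermitian

/-! ### The splitting of the tangent bundle of `T^*M` -/

variable {E : Type*} [NormedAddCommGroup E] [NormedSpace ℝ E] [FiniteDimensional ℝ E]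
  {M : Type*} [TopologicalSpace M] [ChartedSpace E M] [IsManifold 𝓘(ℝ, E) ∞ M]
  (g : ContMDiffRiemannianMetric 𝓘(ℝ, E) ∞ E (fun x : M => TangentSpace 𝓘(ℝ, E) x))

/-- The musical isomorphism `X ↦ X^♭ = g(X, ·)` from `T_x M` to `T^*_x M`. -/
def flat (x : M) : TangentSpace 𝓘(ℝ, E) x ≃ₗ[ℝ] (TangentSpace 𝓘(ℝ, E) x →L[ℝ] ℝ) :=
  LinearEquiv.ofBijective (g.inner x).toLinearMap <| by
    have hinj : Function.Injective (g.inner x).toLinearMap := by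
      rw [← LinearMap.ker_eq_bot, LinearMap.ker_eq_bot']
      intro v hv
      by_contra hne
      have h1 := g.pos x v hne
      have h2 : g.inner x v = 0 := hv
      rw [h2] at h1
      simp at h1
    have hdim : Module.finrank ℝ E = Module.finrank ℝ (E →L[ℝ] ℝ) := by
      rw [← (LinearMap.toContinuousLinearMap : (E →ₗ[ℝ] ℝ) ≃ₗ[ℝ] (E →L[ℝ] ℝ)).finrank_eq]
      exact (Subspace.dual_finrank_eq (K := ℝ) (V := E)).symm
    let f : E →ₗ[ℝ] (E →L[ℝ] ℝ) := (g.inner x).toLinearMap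
    exact ⟨hinj, (LinearMap.injective_iff_surjective_of_finrank_eq_finrank (f := f) hdim).1 hinj⟩

/-- The inverse musical isomorphism `α ↦ α^♯`, characterized by `g(α^♯, Y) = α(Y)`. -/
def sharp (x : M) : (TangentSpace 𝓘(ℝ, E) x →L[ℝ] ℝ) ≃ₗ[ℝ] TangentSpace 𝓘(ℝ, E) x :=
  (flat g x).symm

/-- The inverse metric `g⁻¹(α, β) = α(β^♯)` on `T^*_x M`. -/
def cometric (x : M) (α β : TangentSpace 𝓘(ℝ, E) x →L[ℝ] ℝ) : ℝ := α (sharp g x β)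

/-- The energy density `t = ½ g⁻¹(p, p)` at the cotangent vector `p`. -/
def energy (p : CotangentBundle E M) : ℝ := (1 / 2) * cometric g p.proj p.2 p.2

/-- The metric read in the preferred chart around `x`: `(u, v) ↦ g_{ij}(y) uⁱ vʲ`, the pullback of
`g` under the inverse of the chart. -/
def metricInChart (x : M) (y : E) : E →L[ℝ] E →L[ℝ] ℝ :=
  let A : E →L[ℝ] E := mfderiv 𝓘(ℝ, E) 𝓘(ℝ, E) (extChartAt 𝓘(ℝ, E) x).symm y
  let B : E →L[ℝ] E →L[ℝ] ℝ := g.inner ((extChartAt 𝓘(ℝ, E) x).symm y)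
  B.bilinearComp A A

/-- The derivatives at `x` of the components of the metric in the preferred chart around `x`:
`(w, u, v) ↦ ∂_w g_{ij} uⁱ vʲ`. -/
def metricDeriv (x : M) : E →ₗ[ℝ] E →ₗ[ℝ] E →ₗ[ℝ] ℝ where
  toFun w := LinearMap.mk₂ ℝ
    (fun u v => fderiv ℝ (metricInChart g x) (extChartAt 𝓘(ℝ, E) x x) w u v)
    (fun _ _ _ => by rw [map_add]; rfl) (fun _ _ _ => by rw [map_smul]; rfl)
    (fun _ _ _ => map_add _ _ _) (fun _ _ _ => map_smul _ _ _)
  map_add' w w' := by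
    ext u v
    exact congrArg (fun B : E →L[ℝ] E →L[ℝ] ℝ => B u v) (ContinuousLinearMap.map_add _ w w')
  map_smul' c w := by
    ext u v
    exact congrArg (fun B : E →L[ℝ] E →L[ℝ] ℝ => B u v) (ContinuousLinearMap.map_smul _ c w)

/-- The Christoffel symbols of the first kind of `g` at `x`, in the preferred chart around `x`:
`(u, v) ↦ (w ↦ ½ (∂_u g(v, w) + ∂_v g(u, w) - ∂_w g(u, v)))`. -/
def christoffelFirst (x : M) : E →ₗ[ℝ] E →ₗ[ℝ] E →ₗ[ℝ] ℝ :=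
  LinearMap.mk₂ ℝ
    (fun u v =>
      { toFun := fun w => (1 / 2) *
          (metricDeriv g x u v w + metricDeriv g x v u w - metricDeriv g x w u v)
        map_add' := fun w w' => by simp; ring
        map_smul' := fun c w => by simp; ring })
    (fun u u' v => by ext w; simp; ring)
    (fun c u v => by ext w; simp; ring)
    (fun u v v' => by ext w; simp; ring)
    (fun c u v => by ext w; simp; ring)

/-- The Christoffel symbols `Γ(u, v)` (of the second kind) of the Levi-Civita connection of `g`
at `x`, in the preferred chart around `x`: `g(Γ(u, v), w)` is the symbol of the first kind. -/
def christoffel (x : M) : E →ₗ[ℝ] E →ₗ[ℝ] E :=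
  let s : (E →L[ℝ] ℝ) →ₗ[ℝ] E := (sharp g x).toLinearMap
  (christoffelFirst g x).compr₂
    (s ∘ₗ (LinearMap.toContinuousLinearMap : (E →ₗ[ℝ] ℝ) ≃ₗ[ℝ] (E →L[ℝ] ℝ)).toLinearMap)

/-- The covector `v ↦ p(Γ(u, v))`, in components `p_k Γ^k_{ih} uⁱ`, depending linearly on `u`. -/
def christoffelCovector (p : CotangentBundle E M) : E →ₗ[ℝ] (E →L[ℝ] ℝ) :=
  let q : E →ₗ[ℝ] ℝ := (p.2 : E →L[ℝ] ℝ).toLinearMap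
  let B : E →ₗ[ℝ] E →ₗ[ℝ] ℝ := (christoffel g p.proj).compr₂ q
  (LinearMap.toContinuousLinearMap : (E →ₗ[ℝ] ℝ) ≃ₗ[ℝ] (E →L[ℝ] ℝ)).toLinearMap ∘ₗ B

/-- The horizontal lift `X ↦ X^H` at `p ∈ T^*M` with respect to the Levi-Civita connection of `g`:
in the chart of `T^*M` induced by the preferred chart at the base point, the horizontal lift of
`∂/∂xⁱ` is `δ/δqⁱ = ∂/∂qⁱ + p_k Γ^k_{ih} ∂/∂p_h`. -/
def horizontalLift (p : CotangentBundle E M) :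
    TangentSpace 𝓘(ℝ, E) p.proj →ₗ[ℝ] TangentSpace (cotModel E) p where
  toFun X := ((X, christoffelCovector g p X) : E × (E →L[ℝ] ℝ))
  map_add' X Y := Prod.ext rfl (map_add (christoffelCovector g p) X Y)
  map_smul' c X := Prod.ext rfl (map_smul (christoffelCovector g p) c X)

/-- The vertical lift `α ↦ α^V` at `p ∈ T^*M`: the vertical lift of `dxⁱ` is `∂/∂p_i`. -/
def verticalLift (p : CotangentBundle E M) :
    (TangentSpace 𝓘(ℝ, E) p.proj →L[ℝ] ℝ) →ₗ[ℝ] TangentSpace (cotModel E) p where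
  toFun α := ((0, α) : E × (E →L[ℝ] ℝ))
  map_add' _ _ := Prod.ext (add_zero (0 : E)).symm rfl
  map_smul' c _ := Prod.ext (smul_zero (A := E) c).symm rfl

/-- The horizontal component `X = π_* Z ∈ T_x M` in the splitting `Z = X^H + α^V`. -/
def horizontalPart (p : CotangentBundle E M) :
    TangentSpace (cotModel E) p →ₗ[ℝ] TangentSpace 𝓘(ℝ, E) p.proj where
  toFun Z := (Z : E × (E →L[ℝ] ℝ)).1
  map_add' _ _ := rfl
  map_smul' _ _ := rfl

/-- The vertical component `α ∈ T^*_x M` in the splitting `Z = X^H + α^V`. -/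
def verticalPart (p : CotangentBundle E M) :
    TangentSpace (cotModel E) p →ₗ[ℝ] (TangentSpace 𝓘(ℝ, E) p.proj →L[ℝ] ℝ) where
  toFun Z := ((Z : E × (E →L[ℝ] ℝ)).2
    - christoffelCovector g p (Z : E × (E →L[ℝ] ℝ)).1 : E →L[ℝ] ℝ)
  map_add' Z W := by
    have h := map_add (christoffelCovector g p) (Z : E × (E →L[ℝ] ℝ)).1 (W : E × (E →L[ℝ] ℝ)).1
    have h2 : ∀ a b c d : E →L[ℝ] ℝ, a + b - (c + d) = (a - c) + (b - d) := by
      intros; abel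
    exact (congrArg (fun r : E →L[ℝ] ℝ =>
      (Z : E × (E →L[ℝ] ℝ)).2 + (W : E × (E →L[ℝ] ℝ)).2 - r) h).trans (h2 _ _ _ _)
  map_smul' c Z := by
    have h := map_smul (christoffelCovector g p) c (Z : E × (E →L[ℝ] ℝ)).1
    exact (congrArg (fun r : E →L[ℝ] ℝ => c • (Z : E × (E →L[ℝ] ℝ)).2 - r) h).trans
      (smul_sub c (Z : E × (E →L[ℝ] ℝ)).2 _).symm

/-- Every tangent vector of `T^*M` is the sum of its horizontal and vertical components. -/
theorem horizontalLift_add_verticalLift (p : CotangentBundle E M)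
    (Z : TangentSpace (cotModel E) p) :
    horizontalLift g p (horizontalPart p Z) + verticalLift p (verticalPart g p Z) = Z :=
  Prod.ext (add_zero (Z : E × (E →L[ℝ] ℝ)).1)
    (add_sub_cancel (christoffelCovector g p (Z : E × (E →L[ℝ] ℝ)).1) (Z : E × (E →L[ℝ] ℝ)).2)

/-! ### Natural diagonal structures -/

/-- The coefficients of a natural diagonal `(1, 1)`-tensor field: smooth functions on `[0, ∞)`. -/
structure TensorCoeffs where
  (a₁ a₂ b₁ b₂ : ℝ → ℝ)
  smooth_a₁ : ContDiffOn ℝ ∞ a₁ (Ici 0)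
  smooth_a₂ : ContDiffOn ℝ ∞ a₂ (Ici 0)
  smooth_b₁ : ContDiffOn ℝ ∞ b₁ (Ici 0)
  smooth_b₂ : ContDiffOn ℝ ∞ b₂ (Ici 0)

/-- The coefficients of a natural diagonal metric: smooth functions on `[0, ∞)`. -/
structure MetricCoeffs where
  (c₁ c₂ d₁ d₂ : ℝ → ℝ)
  smooth_c₁ : ContDiffOn ℝ ∞ c₁ (Ici 0)
  smooth_c₂ : ContDiffOn ℝ ∞ c₂ (Ici 0)
  smooth_d₁ : ContDiffOn ℝ ∞ d₁ (Ici 0)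
  smooth_d₂ : ContDiffOn ℝ ∞ d₂ (Ici 0)

/-- The natural diagonal `(1, 1)`-tensor field `P` on `T^*M`:
`P X^H = a₁(t) (X^♭)^V + b₁(t) p(X) p^V` and `P α^V = a₂(t) (α^♯)^H + b₂(t) g⁻¹(p, α) (p^♯)^H`. -/
def diagTensor (A : TensorCoeffs) (p : CotangentBundle E M) :
    TangentSpace (cotModel E) p →ₗ[ℝ] TangentSpace (cotModel E) p :=
  let t := energy g p
  let onHor : TangentSpace 𝓘(ℝ, E) p.proj →ₗ[ℝ] TangentSpace (cotModel E) p :=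
    A.a₁ t • (verticalLift p ∘ₗ (flat g p.proj).toLinearMap)
      + A.b₁ t • p.2.toLinearMap.smulRight (verticalLift p p.2)
  let onVert : (TangentSpace 𝓘(ℝ, E) p.proj →L[ℝ] ℝ) →ₗ[ℝ] TangentSpace (cotModel E) p :=
    A.a₂ t • (horizontalLift g p ∘ₗ (sharp g p.proj).toLinearMap)
      + A.b₂ t • (p.2.toLinearMap ∘ₗ (sharp g p.proj).toLinearMap).smulRight
          (horizontalLift g p (sharp g p.proj p.2))
  onHor ∘ₗ horizontalPart p + onVert ∘ₗ verticalPart g p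

/-- The natural diagonal metric `G` on `T^*M`:
`G(X^H, Y^H) = c₁(t) g(X, Y) + d₁(t) p(X) p(Y)`,
`G(α^V, β^V) = c₂(t) g⁻¹(α, β) + d₂(t) g⁻¹(p, α) g⁻¹(p, β)`,
`G(X^H, α^V) = G(α^V, X^H) = 0`. -/
def diagMetric (C : MetricCoeffs) (p : CotangentBundle E M) :
    TangentSpace (cotModel E) p →ₗ[ℝ] TangentSpace (cotModel E) p →ₗ[ℝ] ℝ :=
  let t := energy g p
  LinearMap.mk₂ ℝ
    (fun Z W =>
      let X := horizontalPart p Z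
      let Y := horizontalPart p W
      let α := verticalPart g p Z
      let β := verticalPart g p W
      (C.c₁ t * g.inner p.proj X Y + C.d₁ t * (p.2 X * p.2 Y))
        + (C.c₂ t * cometric g p.proj α β
          + C.d₂ t * (cometric g p.proj p.2 α * cometric g p.proj p.2 β)))
    (by intro Z Z' W; simp [cometric]; ring)
    (by intro c Z W; simp [cometric]; ring)
    (by intro Z W W'; simp [cometric]; ring)
    (by intro c Z W; simp [cometric]; ring)

/-- `l` and `m` (the functions `λ` and `μ`) are the proportionality coefficients of the pair
`(G, P)`: they are smooth on `[0, ∞)` and satisfy there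
`c₁ / a₁ = - c₂ / a₂ = λ` and
`(c₁ + 2 t d₁) / (a₁ + 2 t b₁) = - (c₂ + 2 t d₂) / (a₂ + 2 t b₂) = λ + 2 t μ`. -/
structure IsProportionality (C : MetricCoeffs) (A : TensorCoeffs) (l m : ℝ → ℝ) : Prop where
  smooth_l : ContDiffOn ℝ ∞ l (Ici 0)
  smooth_m : ContDiffOn ℝ ∞ m (Ici 0)
  first : ∀ t, 0 ≤ t → C.c₁ t / A.a₁ t = l t ∧ - (C.c₂ t / A.a₂ t) = l t
  second : ∀ t, 0 ≤ t →
    (C.c₁ t + 2 * t * C.d₁ t) / (A.a₁ t + 2 * t * A.b₁ t) = l t + 2 * t * m t ∧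
    - ((C.c₂ t + 2 * t * C.d₂ t) / (A.a₂ t + 2 * t * A.b₂ t)) = l t + 2 * t * m t

end NaturalDiagonal

end

/-!
Write `θ` for the tautological `1`-form of `T^*M` and `ω = -dθ` for the canonical symplectic form.

Evaluating `P² = id` and `G(PZ, PW) = -G(Z, W)` on `p` itself and on a covector orthogonal to `p`
(there is one since `n ≥ 2`) gives four scalar relations between the coefficients, at every `t ≥ 0`
since the energy density takes every such value
(`NaturalDiagonal.IsAlmostParaHermitian.coeffRelations`). They make `a₁`, `a₂`, `a₁ + 2 t b₁` and
`a₂ + 2 t b₂` nonzero on `[0, ∞)`, so that `λ = c₁ / a₁` and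
`μ = (a₁ d₁ - b₁ c₁) / (a₁ (a₁ + 2 t b₁))` are smooth there and have the required properties
(`NaturalDiagonal.exists_isProportionality`).

In the horizontal-vertical splitting the fundamental form is then
`Ω(X^H, β^V) = λ β(X) + μ p(X) g⁻¹(p, β)`, with isotropic horizontal and vertical subspaces
(`NaturalDiagonal.fundamentalForm_eq_splitting`). The Levi-Civita connection is torsion-free, so
`ω(X^H, β^V) = β(X)` with the same subspaces isotropic (`NaturalDiagonal.symplectic_eq_splitting`);
it is metric, so `dt` annihilates the horizontal lifts and `dt(β^V) = g⁻¹(p, β)`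
(`NaturalDiagonal.fderiv_energyInChart`). Hence `Ω = λ(t) ω + μ(t) θ ∧ dt`, in every chart of `T^*M`
because `θ`, `ω` and `t` do not depend on the chart (`NaturalDiagonal.formInChart_fundamentalForm`).

Since `dω = 0` and `dθ = -ω`, this yields `dΩ = (λ'(t) - μ(t)) dt ∧ ω`
(`NaturalDiagonal.extDerivManifold_fundamentalForm`), which vanishes if `μ = λ'`. Conversely,
`dt ∧ ω` is nonzero off the zero section when `n ≥ 2`, so that `dΩ = 0` gives `μ(t) = λ'(t)` for
`t > 0` (`NaturalDiagonal.eq_derivWithin_of_extDerivManifold_eq_zero`), and for `t = 0` by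
continuity.
-/

open scoped Topology

set_option linter.unusedSectionVars false

noncomputable section

namespace NaturalDiagonal

variable {E : Type*} [NormedAddCommGroup E] [NormedSpace ℝ E] [FiniteDimensional ℝ E]
  {M : Type*} [TopologicalSpace M] [ChartedSpace E M] [IsManifold 𝓘(ℝ, E) ∞ M]
  (g : ContMDiffRiemannianMetric 𝓘(ℝ, E) ∞ E (fun x : M => TangentSpace 𝓘(ℝ, E) x))

/-! ### The cometric and the horizontal-vertical splitting -/

theorem inner_sharp (x : M) (α : TangentSpace 𝓘(ℝ, E) x →L[ℝ] ℝ) (v : TangentSpace 𝓘(ℝ, E) x) :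
    g.inner x (sharp g x α) v = α v :=
  congrArg (fun β : TangentSpace 𝓘(ℝ, E) x →L[ℝ] ℝ => β v) ((flat g x).apply_symm_apply α)

theorem flat_sharp (x : M) (α : TangentSpace 𝓘(ℝ, E) x →L[ℝ] ℝ) : flat g x (sharp g x α) = α :=
  (flat g x).apply_symm_apply α

theorem sharp_flat (x : M) (v : TangentSpace 𝓘(ℝ, E) x) : sharp g x (flat g x v) = v :=
  (flat g x).symm_apply_apply v

theorem cometric_comm (x : M) (α β : TangentSpace 𝓘(ℝ, E) x →L[ℝ] ℝ) :
    cometric g x α β = cometric g x β α := by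
  rw [cometric, cometric, ← inner_sharp g, g.symm, inner_sharp]

theorem cometric_pos (x : M) {α : TangentSpace 𝓘(ℝ, E) x →L[ℝ] ℝ} (hα : α ≠ 0) :
    0 < cometric g x α α := by
  rw [cometric, ← inner_sharp g]
  refine g.pos x _ fun h => hα ?_
  rw [← flat_sharp g x α, h, map_zero]

theorem cometric_self_nonneg (x : M) (α : TangentSpace 𝓘(ℝ, E) x →L[ℝ] ℝ) :
    0 ≤ cometric g x α α := by
  rcases eq_or_ne α 0 with rfl | h
  · simp [cometric]
  · exact (cometric_pos g x h).le

theorem energy_nonneg (p : CotangentBundle E M) : 0 ≤ energy g p :=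
  mul_nonneg (by norm_num) (cometric_self_nonneg g _ _)

theorem cometric_self (p : CotangentBundle E M) :
    cometric g p.proj p.2 p.2 = 2 * energy g p := by
  rw [energy]; ring

/-- In dimension at least two every covector has a nonzero covector orthogonal to it. -/
theorem exists_cometric_eq_zero (hdim : 2 ≤ Module.finrank ℝ E) (x : M)
    (α : TangentSpace 𝓘(ℝ, E) x →L[ℝ] ℝ) :
    ∃ β : TangentSpace 𝓘(ℝ, E) x →L[ℝ] ℝ, β ≠ 0 ∧ cometric g x α β = 0 := by
  obtain ⟨v, hv, hv0⟩ : ∃ v : E, (α : E →L[ℝ] ℝ) v = 0 ∧ v ≠ 0 := by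
    let f : E →ₗ[ℝ] ℝ := (α : E →L[ℝ] ℝ).toLinearMap
    have h1 : Module.finrank ℝ ℝ < Module.finrank ℝ E := by
      rw [Module.finrank_self]; omega
    obtain ⟨v, hv, hv0⟩ :=
      (Submodule.ne_bot_iff _).1 (LinearMap.ker_ne_bot_of_finrank_lt (f := f) h1)
    exact ⟨v, hv, hv0⟩
  refine ⟨flat g x v, fun h => hv0 ?_, ?_⟩
  · rw [← sharp_flat g x v, h, map_zero]; rfl
  · exact (congrArg α (sharp_flat g x v)).trans hv

/-- Every nonnegative number is the energy density of some cotangent vector. -/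
theorem exists_energy_eq [Nonempty M] (hdim : 2 ≤ Module.finrank ℝ E) {t : ℝ} (ht : 0 ≤ t) :
    ∃ p : CotangentBundle E M, energy g p = t := by
  obtain ⟨x⟩ := ‹Nonempty M›
  obtain ⟨β, hβ, -⟩ := exists_cometric_eq_zero g hdim x 0
  have hpos := cometric_pos g x hβ
  refine ⟨⟨x, Real.sqrt (2 * t / cometric g x β β) • β⟩, ?_⟩
  have h2 : cometric g x (Real.sqrt (2 * t / cometric g x β β) • β)
      (Real.sqrt (2 * t / cometric g x β β) • β) = 2 * t := by
    simp only [cometric, map_smul, smul_apply, smul_eq_mul] at hpos ⊢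
    rw [← mul_assoc, Real.mul_self_sqrt (by positivity)]
    field_simp
  rw [energy, h2]; ring

theorem horizontalPart_horizontalLift (p : CotangentBundle E M) (X : TangentSpace 𝓘(ℝ, E) p.proj) :
    horizontalPart p (horizontalLift g p X) = X := rfl

theorem horizontalPart_verticalLift (p : CotangentBundle E M)
    (α : TangentSpace 𝓘(ℝ, E) p.proj →L[ℝ] ℝ) :
    horizontalPart p (verticalLift p α) = 0 := rfl

theorem verticalPart_horizontalLift (p : CotangentBundle E M) (X : TangentSpace 𝓘(ℝ, E) p.proj) :
    verticalPart g p (horizontalLift g p X) = 0 :=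
  sub_self (christoffelCovector g p X)

theorem verticalPart_verticalLift (p : CotangentBundle E M)
    (α : TangentSpace 𝓘(ℝ, E) p.proj →L[ℝ] ℝ) :
    verticalPart g p (verticalLift p α) = α := by
  change (show E →L[ℝ] ℝ from α) - christoffelCovector g p 0 = α
  rw [map_zero, sub_zero]

/-! ### Algebraic conditions on the coefficients -/

theorem diagTensor_horizontalLift (A : TensorCoeffs) (p : CotangentBundle E M)
    (X : TangentSpace 𝓘(ℝ, E) p.proj) :
    diagTensor g A p (horizontalLift g p X) =
      verticalLift p (A.a₁ (energy g p) • flat g p.proj X + (A.b₁ (energy g p) * p.2 X) • p.2) := by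
  simp [diagTensor, horizontalPart_horizontalLift, verticalPart_horizontalLift, mul_smul]

theorem diagTensor_verticalLift (A : TensorCoeffs) (p : CotangentBundle E M)
    (α : TangentSpace 𝓘(ℝ, E) p.proj →L[ℝ] ℝ) :
    diagTensor g A p (verticalLift p α) =
      horizontalLift g p (A.a₂ (energy g p) • sharp g p.proj α
        + (A.b₂ (energy g p) * cometric g p.proj p.2 α) • sharp g p.proj p.2) := by
  simp [diagTensor, horizontalPart_verticalLift, verticalPart_verticalLift, mul_smul, cometric]

theorem diagMetric_horizontalLift (C : MetricCoeffs) (p : CotangentBundle E M)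
    (X Y : TangentSpace 𝓘(ℝ, E) p.proj) :
    diagMetric g C p (horizontalLift g p X) (horizontalLift g p Y) =
      C.c₁ (energy g p) * g.inner p.proj X Y + C.d₁ (energy g p) * (p.2 X * p.2 Y) := by
  simp [diagMetric, horizontalPart_horizontalLift, verticalPart_horizontalLift, cometric]

theorem diagMetric_verticalLift (C : MetricCoeffs) (p : CotangentBundle E M)
    (α β : TangentSpace 𝓘(ℝ, E) p.proj →L[ℝ] ℝ) :
    diagMetric g C p (verticalLift p α) (verticalLift p β) =
      C.c₂ (energy g p) * cometric g p.proj α β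
        + C.d₂ (energy g p) * (cometric g p.proj p.2 α * cometric g p.proj p.2 β) := by
  simp [diagMetric, horizontalPart_verticalLift, verticalPart_verticalLift]

theorem diagMetric_horizontalLift_verticalLift (C : MetricCoeffs) (p : CotangentBundle E M)
    (X : TangentSpace 𝓘(ℝ, E) p.proj) (β : TangentSpace 𝓘(ℝ, E) p.proj →L[ℝ] ℝ) :
    diagMetric g C p (horizontalLift g p X) (verticalLift p β) = 0 := by
  simp [diagMetric, horizontalPart_verticalLift, verticalPart_verticalLift,
    horizontalPart_horizontalLift, verticalPart_horizontalLift, cometric]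

theorem diagMetric_verticalLift_horizontalLift (C : MetricCoeffs) (p : CotangentBundle E M)
    (α : TangentSpace 𝓘(ℝ, E) p.proj →L[ℝ] ℝ) (Y : TangentSpace 𝓘(ℝ, E) p.proj) :
    diagMetric g C p (verticalLift p α) (horizontalLift g p Y) = 0 := by
  simp [diagMetric, horizontalPart_verticalLift, verticalPart_verticalLift,
    horizontalPart_horizontalLift, verticalPart_horizontalLift, cometric]

/-- The scalar conditions under which `(G, P)` is almost para-Hermitian: on the covectors orthogonal
to `p`, and on the line of `p` itself, `P² = id` and `G(PX, PY) = -G(X, Y)` each amount to one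
equation between the coefficients. -/
structure CoeffRelations (C : MetricCoeffs) (A : TensorCoeffs) (t : ℝ) : Prop where
  a_mul : A.a₁ t * A.a₂ t = 1
  ab_mul : (A.a₁ t + 2 * t * A.b₁ t) * (A.a₂ t + 2 * t * A.b₂ t) = 1
  c_eq : C.c₁ t = -(C.c₂ t * A.a₁ t ^ 2)
  cd_eq : C.c₁ t + 2 * t * C.d₁ t
    = -((C.c₂ t + 2 * t * C.d₂ t) * (A.a₁ t + 2 * t * A.b₁ t) ^ 2)

variable {g}

/-- Away from the zero section the relations come from evaluating `P² = id` and the compatibility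
condition on `p` and on a covector orthogonal to `p`; at `t = 0` the two pairs of relations
coincide. -/
theorem IsAlmostParaHermitian.coeffRelations [Nonempty M] (hdim : 2 ≤ Module.finrank ℝ E)
    {C : MetricCoeffs} {A : TensorCoeffs}
    (h : IsAlmostParaHermitian (diagMetric g C) (diagTensor g A)) {t : ℝ} (ht : 0 ≤ t) :
    CoeffRelations C A t := by
  obtain ⟨p, rfl⟩ := exists_energy_eq g hdim ht
  obtain ⟨β, hβ, hpβ⟩ := exists_cometric_eq_zero g hdim p.proj p.2
  have hββ := cometric_pos g p.proj hβ
  have a_mul : A.a₁ (energy g p) * A.a₂ (energy g p) = 1 := by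
    have h1 := congrArg (verticalPart g p) (h.sq_eq_id p (verticalLift p β))
    have hpβ' : p.2 (sharp g p.proj β) = 0 := hpβ
    rw [diagTensor_verticalLift, hpβ, mul_zero, zero_smul, add_zero, diagTensor_horizontalLift,
      verticalPart_verticalLift, verticalPart_verticalLift, map_smul, map_smul, flat_sharp,
      hpβ', smul_zero, mul_zero, zero_smul, add_zero, smul_smul] at h1
    have h2 := congrArg (fun γ => cometric g p.proj γ β) h1
    simp only [cometric, smul_apply, smul_eq_mul] at h2 hββ
    exact mul_right_cancel₀ hββ.ne' (h2.trans (one_mul _).symm)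
  have c_eq : C.c₁ (energy g p) = -(C.c₂ (energy g p) * A.a₁ (energy g p) ^ 2) := by
    have h1 := h.compat p (horizontalLift g p (sharp g p.proj β))
      (horizontalLift g p (sharp g p.proj β))
    have hpβ' : p.2 (sharp g p.proj β) = 0 := hpβ
    rw [diagTensor_horizontalLift, hpβ', mul_zero, zero_smul, add_zero, flat_sharp,
      diagMetric_verticalLift, diagMetric_horizontalLift, inner_sharp, hpβ'] at h1
    simp only [cometric, smul_apply, smul_eq_mul, map_smul] at h1 hββ
    rw [hpβ'] at h1
    refine mul_right_cancel₀ hββ.ne' ?_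
    linear_combination h1
  rcases ht.eq_or_lt with h0 | h0
  · rw [← h0] at a_mul c_eq ⊢
    exact ⟨a_mul, by simpa using a_mul, c_eq, by simpa using c_eq⟩
  have hpp := cometric_self g p
  have hpp' : p.2 (sharp g p.proj p.2) = 2 * energy g p := hpp
  refine ⟨a_mul, ?_, c_eq, ?_⟩
  · have h1 := congrArg (verticalPart g p) (h.sq_eq_id p (verticalLift p p.2))
    rw [diagTensor_verticalLift, hpp, ← add_smul, diagTensor_horizontalLift,
      verticalPart_verticalLift, verticalPart_verticalLift, map_smul, map_smul, flat_sharp,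
      hpp', smul_smul, ← add_smul] at h1
    have h2 := congrArg (fun γ => cometric g p.proj γ p.2) h1
    simp only [cometric, smul_apply, smul_eq_mul, hpp'] at h2
    refine mul_right_cancel₀ (mul_ne_zero two_ne_zero h0.ne') ?_
    linear_combination h2
  · have h1 := h.compat p (horizontalLift g p (sharp g p.proj p.2))
      (horizontalLift g p (sharp g p.proj p.2))
    rw [diagTensor_horizontalLift, hpp', flat_sharp, ← add_smul,
      diagMetric_verticalLift, diagMetric_horizontalLift, inner_sharp, hpp'] at h1
    simp only [cometric, smul_apply, smul_eq_mul, map_smul, hpp'] at h1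
    refine mul_right_cancel₀ (mul_ne_zero two_ne_zero h0.ne') ?_
    linear_combination h1

theorem CoeffRelations.a₁_ne {C : MetricCoeffs} {A : TensorCoeffs} {t : ℝ}
    (h : CoeffRelations C A t) : A.a₁ t ≠ 0 := left_ne_zero_of_mul_eq_one h.a_mul

theorem CoeffRelations.a₂_ne {C : MetricCoeffs} {A : TensorCoeffs} {t : ℝ}
    (h : CoeffRelations C A t) : A.a₂ t ≠ 0 := right_ne_zero_of_mul_eq_one h.a_mul

theorem CoeffRelations.ab₁_ne {C : MetricCoeffs} {A : TensorCoeffs} {t : ℝ}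
    (h : CoeffRelations C A t) : A.a₁ t + 2 * t * A.b₁ t ≠ 0 :=
  left_ne_zero_of_mul_eq_one h.ab_mul

theorem CoeffRelations.ab₂_ne {C : MetricCoeffs} {A : TensorCoeffs} {t : ℝ}
    (h : CoeffRelations C A t) : A.a₂ t + 2 * t * A.b₂ t ≠ 0 :=
  right_ne_zero_of_mul_eq_one h.ab_mul

/-- The function `μ` is `(a₁ d₁ - b₁ c₁) / (a₁ (a₁ + 2 t b₁))`: subtracting `λ = c₁ / a₁` from
`(c₁ + 2 t d₁) / (a₁ + 2 t b₁)` leaves a numerator divisible by `2 t`. -/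
theorem exists_isProportionality {C : MetricCoeffs} {A : TensorCoeffs}
    (h : ∀ t, 0 ≤ t → CoeffRelations C A t) : ∃ l m, IsProportionality C A l m := by
  refine ⟨fun t => C.c₁ t / A.a₁ t,
    fun t => (A.a₁ t * C.d₁ t - C.c₁ t * A.b₁ t) / (A.a₁ t * (A.a₁ t + 2 * t * A.b₁ t)),
    ?_, ?_, ?_, ?_⟩
  · exact C.smooth_c₁.div A.smooth_a₁ fun t ht => (h t ht).a₁_ne
  · refine ((A.smooth_a₁.mul C.smooth_d₁).sub (C.smooth_c₁.mul A.smooth_b₁)).div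
      (A.smooth_a₁.mul (A.smooth_a₁.add ((contDiffOn_const.mul contDiffOn_id).mul A.smooth_b₁)))
      fun t ht => mul_ne_zero (h t ht).a₁_ne (h t ht).ab₁_ne
  · intro t ht
    have h1 := (h t ht).a₁_ne
    have h2 := (h t ht).a₂_ne
    refine ⟨rfl, ?_⟩
    rw [← neg_div, div_eq_div_iff h2 h1, (h t ht).c_eq]
    linear_combination (C.c₂ t * A.a₁ t) * (h t ht).a_mul
  · intro t ht
    have h1 := (h t ht).a₁_ne
    have h2 := (h t ht).ab₁_ne
    have h3 := (h t ht).ab₂_ne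
    have key : (C.c₁ t + 2 * t * C.d₁ t) / (A.a₁ t + 2 * t * A.b₁ t) = C.c₁ t / A.a₁ t + 2 * t *
        ((A.a₁ t * C.d₁ t - C.c₁ t * A.b₁ t) / (A.a₁ t * (A.a₁ t + 2 * t * A.b₁ t))) := by
      rw [← mul_div_assoc, div_add_div _ _ h1 (mul_ne_zero h1 h2),
        div_eq_div_iff h2 (mul_ne_zero h1 (mul_ne_zero h1 h2))]
      ring
    refine ⟨key, ?_⟩
    rw [← key, ← neg_div, div_eq_div_iff h3 h2, (h t ht).cd_eq]
    linear_combination ((C.c₂ t + 2 * t * C.d₂ t) * (A.a₁ t + 2 * t * A.b₁ t)) * (h t ht).ab_mul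

/-- In terms of the splitting, `Ω(X^H, β^V) = λ β(X) + μ p(X) g⁻¹(p, β)`, and the horizontal and the
vertical subspaces are isotropic. -/
theorem fundamentalForm_eq_splitting {C : MetricCoeffs} {A : TensorCoeffs}
    (h : IsAlmostParaHermitian (diagMetric g C) (diagTensor g A)) {l m : ℝ → ℝ}
    (hlm : IsProportionality C A l m) (p : CotangentBundle E M)
    (hrel : CoeffRelations C A (energy g p)) (v : Fin 2 → TangentSpace (cotModel E) p) :
    fundamentalForm h p v =
      l (energy g p) * (verticalPart g p (v 1) (horizontalPart p (v 0))
          - verticalPart g p (v 0) (horizontalPart p (v 1)))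
        + m (energy g p) *
          (p.2 (horizontalPart p (v 0)) * cometric g p.proj p.2 (verticalPart g p (v 1))
            - p.2 (horizontalPart p (v 1)) * cometric g p.proj p.2 (verticalPart g p (v 0))) := by
  have ht := energy_nonneg g p
  have mixed : ∀ X β, diagMetric g C p (horizontalLift g p X)
      (diagTensor g A p (verticalLift p β)) =
        l (energy g p) * β X + m (energy g p) * (p.2 X * cometric g p.proj p.2 β) := by
    intro X β
    have e1 := (hlm.first _ ht).1
    have e2 := (hlm.second _ ht).1
    have h1 := hrel.a₁_ne
    have h2 := hrel.ab₁_ne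
    have e1' : C.c₁ (energy g p) * A.a₂ (energy g p) = l (energy g p) := by
      rw [← e1, eq_div_iff h1]
      linear_combination C.c₁ (energy g p) * hrel.a_mul
    have e2' : (C.c₁ (energy g p) + 2 * energy g p * C.d₁ (energy g p))
        * (A.a₂ (energy g p) + 2 * energy g p * A.b₂ (energy g p))
        = l (energy g p) + 2 * energy g p * m (energy g p) := by
      rw [← e2, eq_div_iff h2]
      linear_combination (C.c₁ (energy g p) + 2 * energy g p * C.d₁ (energy g p)) * hrel.ab_mul
    have hpp' : p.2 (sharp g p.proj p.2) = 2 * energy g p := cometric_self g p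
    have hX : g.inner p.proj X (sharp g p.proj β) = β X := by rw [g.symm, inner_sharp]
    have hX' : g.inner p.proj X (sharp g p.proj p.2) = p.2 X := by rw [g.symm, inner_sharp]
    rw [diagTensor_verticalLift, diagMetric_horizontalLift]
    simp only [map_add, map_smul, smul_eq_mul, hX, hX', hpp']
    change _ = l (energy g p) * β X + m (energy g p) * (p.2 X * p.2 (sharp g p.proj β))
    change C.c₁ (energy g p) * (A.a₂ (energy g p) * β X
      + A.b₂ (energy g p) * p.2 (sharp g p.proj β) * p.2 X) + C.d₁ (energy g p) * (p.2 X *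
        (A.a₂ (energy g p) * p.2 (sharp g p.proj β)
          + A.b₂ (energy g p) * p.2 (sharp g p.proj β) * (2 * energy g p))) = _
    rcases ht.eq_or_lt with h0 | h0
    · -- at `t = 0` the covector `p` vanishes, and only the term `λ β(X)` survives
      have hp0 : p.2 = 0 := by
        by_contra hne
        have := cometric_pos g p.proj hne
        rw [cometric_self, ← h0] at this
        simp at this
      rw [← e1', hp0]
      simp
      ring
    · refine mul_left_cancel₀ (mul_ne_zero two_ne_zero h0.ne') ?_
      linear_combination (2 * energy g p * β X - p.2 X * p.2 (sharp g p.proj β)) * e1'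
        + p.2 X * p.2 (sharp g p.proj β) * e2'
  have swap : ∀ α Y, diagMetric g C p (verticalLift p α)
      (diagTensor g A p (horizontalLift g p Y)) = - diagMetric g C p (horizontalLift g p Y)
      (diagTensor g A p (verticalLift p α)) := by
    intro α Y
    have h1 := h.compat p (verticalLift p α) (diagTensor g A p (horizontalLift g p Y))
    rw [h.sq_eq_id, h.symm] at h1
    linarith
  change diagMetric g C p (v 0) (diagTensor g A p (v 1)) = _
  conv_lhs => rw [← horizontalLift_add_verticalLift g p (v 0),
    ← horizontalLift_add_verticalLift g p (v 1)]
  simp only [map_add, LinearMap.add_apply]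
  rw [swap, mixed, mixed, diagTensor_horizontalLift, diagTensor_verticalLift,
    diagMetric_horizontalLift_verticalLift, diagMetric_verticalLift_horizontalLift]
  ring

/-! ### Charts of the cotangent bundle and the canonical symplectic form -/

section Charts

variable {F : Type*} [NormedAddCommGroup F] [NormedSpace ℝ F]
  {H : Type*} [TopologicalSpace H] {I : ModelWithCorners ℝ F H}
  {N : Type*} [TopologicalSpace N] [ChartedSpace H N] [IsManifold I 1 N]

theorem mfderivWithin_extChartAt_symm_eq_tangentCoordChange {x z : N}
    (hz : z ∈ (extChartAt I x).source) :
    mfderivWithin 𝓘(ℝ, F) I (extChartAt I x).symm (range I) (extChartAt I x z) =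
      tangentCoordChange I x z z := by
  have hz' : z ∈ (chartAt H x).source := by rwa [extChartAt_source] at hz
  have h1 := TangentBundle.symmL_trivializationAt (I := I) (𝕜 := ℝ) hz'
  rw [TangentBundle.symmL_trivializationAt_eq_core hz'] at h1
  exact h1.symm

/-- The local expression of a form at a point of the chart domain, with the derivative of the
inverse chart written as a change of coordinates between the preferred charts. -/
theorem formInChart_extChartAt {k : ℕ} (θ : ∀ x : N, TangentSpace I x [⋀^Fin k]→L[ℝ] ℝ) {x z : N}
    (hz : z ∈ (extChartAt I x).source) (v : Fin k → F) :
    formInChart I θ x (extChartAt I x z) v = θ z (fun i => tangentCoordChange I x z z (v i)) := by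
  unfold formInChart
  rw [mfderivWithin_extChartAt_symm_eq_tangentCoordChange hz]
  change θ ((extChartAt I x).symm (extChartAt I x z))
    (fun i => tangentCoordChange I x z z (v i)) = _
  rw [(extChartAt I x).left_inv hz]

theorem hasFDerivAt_tangentCoordChange [I.Boundaryless] {x y z : N}
    (hx : z ∈ (extChartAt I x).source) (hy : z ∈ (extChartAt I y).source) :
    HasFDerivAt (extChartAt I y ∘ (extChartAt I x).symm) (tangentCoordChange I x y z)
      (extChartAt I x z) := by
  have h := hasFDerivWithinAt_tangentCoordChange (I := I) ⟨hx, hy⟩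
  rwa [I.range_eq_univ, hasFDerivWithinAt_univ] at h

end Charts

/-- The chart of `T^*M` around `p` sends `q` to the coordinates of its base point and the components
of `q` in these coordinates. -/
theorem extChartAt_cotangent (p q : CotangentBundle E M)
    (hq : q.proj ∈ (extChartAt 𝓘(ℝ, E) p.proj).source) :
    extChartAt (cotModel E) p q = (extChartAt 𝓘(ℝ, E) p.proj q.proj,
      (show E →L[ℝ] ℝ from q.2).comp (tangentCoordChange 𝓘(ℝ, E) p.proj q.proj q.proj)) := by
  rw [extChartAt_source] at hq
  change ((chartAt (ModelProd E (E →L[ℝ] ℝ)) p) q) = _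
  rw [hom_chart, ContinuousLinearMap.inCoordinates,
    TangentBundle.symmL_trivializationAt_eq_core hq]
  refine Prod.ext rfl ?_
  ext v
  simp
  rfl

theorem extChartAt_cotangent_self (p : CotangentBundle E M) :
    extChartAt (cotModel E) p p = (extChartAt 𝓘(ℝ, E) p.proj p.proj, (p.2 : E →L[ℝ] ℝ)) := by
  rw [extChartAt_cotangent p p (mem_extChartAt_source _)]
  refine Prod.ext rfl (ContinuousLinearMap.ext fun v => ?_)
  exact congrArg (show E →L[ℝ] ℝ from p.2) (tangentCoordChange_self (mem_extChartAt_source _))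

theorem mem_extChartAt_cotangent_source {p q : CotangentBundle E M} :
    q ∈ (extChartAt (cotModel E) p).source ↔ q.proj ∈ (extChartAt 𝓘(ℝ, E) p.proj).source := by
  rw [extChartAt_source, extChartAt_source, FiberBundle.chartedSpace_chartAt]
  simp only [mfld_simps]
  constructor
  · exact fun h => h.2
  · exact fun h => ⟨⟨h, mem_univ _⟩, h⟩

theorem extChartAt_cotangent_symm_proj {p : CotangentBundle E M} {y : E × (E →L[ℝ] ℝ)}
    (hy : y ∈ (extChartAt (cotModel E) p).target) :
    ((extChartAt (cotModel E) p).symm y).proj = (extChartAt 𝓘(ℝ, E) p.proj).symm y.1 := by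
  have h1 := (extChartAt (cotModel E) p).map_target hy
  have h2 := (extChartAt (cotModel E) p).right_inv hy
  have h3 := mem_extChartAt_cotangent_source.1 h1
  rw [extChartAt_cotangent _ _ h3] at h2
  rw [← congrArg Prod.fst h2]
  exact ((extChartAt 𝓘(ℝ, E) p.proj).left_inv h3).symm

/-- The base component of a change of charts of `T^*M` is the change of charts of `M`. -/
theorem tangentCoordChange_cotangent_fst {p₀ p₁ q : CotangentBundle E M}
    (h₀ : q ∈ (extChartAt (cotModel E) p₀).source) (h₁ : q ∈ (extChartAt (cotModel E) p₁).source)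
    (Z : E × (E →L[ℝ] ℝ)) :
    (tangentCoordChange (cotModel E) p₀ p₁ q Z).1 =
      tangentCoordChange 𝓘(ℝ, E) p₀.proj p₁.proj q.proj Z.1 := by
  have h₀' := mem_extChartAt_cotangent_source.1 h₀
  have h₁' := mem_extChartAt_cotangent_source.1 h₁
  have e0 := congrArg Prod.fst (extChartAt_cotangent p₀ q h₀')
  have d1 := (hasFDerivAt_tangentCoordChange h₀ h₁).fst
  have d2 : HasFDerivAt
      ((extChartAt 𝓘(ℝ, E) p₁.proj ∘ (extChartAt 𝓘(ℝ, E) p₀.proj).symm) ∘ Prod.fst)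
      ((tangentCoordChange 𝓘(ℝ, E) p₀.proj p₁.proj q.proj).comp
        (ContinuousLinearMap.fst ℝ E (E →L[ℝ] ℝ))) (extChartAt (cotModel E) p₀ q) := by
    refine HasFDerivAt.comp _ ?_ hasFDerivAt_fst
    rw [e0]
    exact hasFDerivAt_tangentCoordChange h₀' h₁'
  have hev : (fun y => ((extChartAt (cotModel E) p₁ ∘ (extChartAt (cotModel E) p₀).symm) y).1)
      =ᶠ[𝓝 (extChartAt (cotModel E) p₀ q)]
      ((extChartAt 𝓘(ℝ, E) p₁.proj ∘ (extChartAt 𝓘(ℝ, E) p₀.proj).symm) ∘ Prod.fst) := by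
    filter_upwards [extChartAt_target_mem_nhds' (I := cotModel E)
      ((extChartAt (cotModel E) p₀).map_source h₀)] with y hy
    change extChartAt 𝓘(ℝ, E) p₁.proj ((extChartAt (cotModel E) p₀).symm y).proj = _
    rw [extChartAt_cotangent_symm_proj hy]
    rfl
  have := (d2.congr_of_eventuallyEq hev).unique d1
  exact (congrArg (fun L : E × (E →L[ℝ] ℝ) →L[ℝ] E => L Z) this).symm

/-- The tautological `1`-form `θ_y(Z) = π(X)` on `E × E^*`, at `y = (q, π)` and for `Z = (X, ξ)`,
as a bilinear map of `y` and `Z`. -/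
def tautological (E : Type*) [NormedAddCommGroup E] [NormedSpace ℝ E] :
    E × (E →L[ℝ] ℝ) →L[ℝ] E × (E →L[ℝ] ℝ) →L[ℝ] ℝ :=
  ((ContinuousLinearMap.compL ℝ (E × (E →L[ℝ] ℝ)) E ℝ).flip (ContinuousLinearMap.fst ℝ _ _)).comp
    (ContinuousLinearMap.snd ℝ _ _)

theorem tautological_apply (y Z : E × (E →L[ℝ] ℝ)) : tautological E y Z = y.2 Z.1 := rfl

/-- The tautological `1`-form `θ_p(Z) = p(π_* Z)` has the same expression in all charts. -/
theorem tautological_tangentCoordChange {p₀ p₁ q : CotangentBundle E M}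
    (h₀ : q ∈ (extChartAt (cotModel E) p₀).source) (h₁ : q ∈ (extChartAt (cotModel E) p₁).source)
    (Z : E × (E →L[ℝ] ℝ)) :
    tautological E (extChartAt (cotModel E) p₁ q) (tangentCoordChange (cotModel E) p₀ p₁ q Z) =
      tautological E (extChartAt (cotModel E) p₀ q) Z := by
  have h₀' := mem_extChartAt_cotangent_source.1 h₀
  have h₁' := mem_extChartAt_cotangent_source.1 h₁
  rw [tautological_apply, tautological_apply, tangentCoordChange_cotangent_fst h₀ h₁,
    extChartAt_cotangent p₀ q h₀', extChartAt_cotangent p₁ q h₁']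
  exact congrArg (show E →L[ℝ] ℝ from q.2)
    (tangentCoordChange_comp ⟨⟨h₀', h₁'⟩, mem_extChartAt_source _⟩)

/-- If a map `Ψ` preserves the `1`-form `y ↦ β y` with linear coefficients, then its derivative
preserves the exterior derivative of this form: differentiating the invariance along `W` and
antisymmetrizing removes the second derivative of `Ψ`. -/
theorem sub_swap_fderiv_eq_of_eventuallyEq {V : Type*} [NormedAddCommGroup V] [NormedSpace ℝ V]
    (β : V →L[ℝ] V →L[ℝ] ℝ) {Ψ : V → V} {y₀ : V} (hΨ : ContDiffAt ℝ 2 Ψ y₀)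
    (hinv : ∀ Z, (fun y => β (Ψ y) (fderiv ℝ Ψ y Z)) =ᶠ[𝓝 y₀] fun y => β y Z) (Z W : V) :
    β (fderiv ℝ Ψ y₀ W) (fderiv ℝ Ψ y₀ Z) - β (fderiv ℝ Ψ y₀ Z) (fderiv ℝ Ψ y₀ W) =
      β W Z - β Z W := by
  have hdiff : ∀ Z W, β (fderiv ℝ Ψ y₀ W) (fderiv ℝ Ψ y₀ Z)
      + β (Ψ y₀) (fderiv ℝ (fderiv ℝ Ψ) y₀ W Z) = β W Z := by
    intro Z W
    have d0 : HasFDerivAt Ψ (fderiv ℝ Ψ y₀) y₀ :=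
      (hΨ.differentiableAt (by norm_num)).hasFDerivAt
    have d1 : HasFDerivAt (fderiv ℝ Ψ) (fderiv ℝ (fderiv ℝ Ψ) y₀) y₀ :=
      ((hΨ.fderiv_right (m := 1) (by norm_num)).differentiableAt (by norm_num)).hasFDerivAt
    have d2 := (β.hasFDerivAt.comp y₀ d0).clm_apply (d1.clm_apply (hasFDerivAt_const Z y₀))
    have d3 := (β.hasFDerivAt (x := y₀)).clm_apply (hasFDerivAt_const Z y₀)
    have h := congrArg (fun L : V →L[ℝ] ℝ => L W)
      ((d3.congr_of_eventuallyEq (hinv Z)).unique d2)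
    simp at h
    linarith
  have hsymm := hΨ.isSymmSndFDerivAt (by simp) Z W
  have hZW := hdiff Z W
  have hWZ := hdiff W Z
  rw [hsymm] at hWZ
  linarith

/-- The canonical symplectic form `ω((X, ξ), (Y, η)) = η(X) - ξ(Y)`, the negative of the exterior
derivative of the tautological form, has the same expression in all charts of `T^*M`. -/
theorem symplectic_tangentCoordChange {p₀ p₁ q : CotangentBundle E M}
    (h₀ : q ∈ (extChartAt (cotModel E) p₀).source) (h₁ : q ∈ (extChartAt (cotModel E) p₁).source)
    (Z W : E × (E →L[ℝ] ℝ)) :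
    tautological E (tangentCoordChange (cotModel E) p₀ p₁ q W)
        (tangentCoordChange (cotModel E) p₀ p₁ q Z)
      - tautological E (tangentCoordChange (cotModel E) p₀ p₁ q Z)
        (tangentCoordChange (cotModel E) p₀ p₁ q W) =
      tautological E W Z - tautological E Z W := by
  have hd : ∀ q', q' ∈ (extChartAt (cotModel E) p₀).source →
      q' ∈ (extChartAt (cotModel E) p₁).source →
      fderiv ℝ (extChartAt (cotModel E) p₁ ∘ (extChartAt (cotModel E) p₀).symm)
        (extChartAt (cotModel E) p₀ q') = tangentCoordChange (cotModel E) p₀ p₁ q' :=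
    fun q' h h' => (hasFDerivAt_tangentCoordChange h h').fderiv
  rw [← hd q h₀ h₁]
  refine sub_swap_fderiv_eq_of_eventuallyEq (tautological E) ?_ (fun V => ?_) Z W
  · have hsrc : extChartAt (cotModel E) p₀ q ∈
        ((extChartAt (cotModel E) p₀).symm ≫ extChartAt (cotModel E) p₁).source := by
      rw [PartialEquiv.trans_source, PartialEquiv.symm_source]
      refine ⟨(extChartAt (cotModel E) p₀).map_source h₀, ?_⟩
      rw [mem_preimage, (extChartAt (cotModel E) p₀).left_inv h₀]
      exact h₁
    have h := contDiffWithinAt_ext_coord_change (I := cotModel E) (n := ∞) p₁ p₀ hsrc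
    rw [(cotModel E).range_eq_univ, contDiffWithinAt_univ] at h
    exact h.of_le ENat.LEInfty.out
  · have hc := continuousAt_extChartAt_symm' h₀
    have hn : (extChartAt (cotModel E) p₁).source ∈
        𝓝 ((extChartAt (cotModel E) p₀).symm (extChartAt (cotModel E) p₀ q)) := by
      rw [(extChartAt (cotModel E) p₀).left_inv h₀]
      exact extChartAt_source_mem_nhds' h₁
    filter_upwards [extChartAt_target_mem_nhds' (I := cotModel E)
      ((extChartAt (cotModel E) p₀).map_source h₀), hc.preimage_mem_nhds hn] with y hy hy1
    have hs := (extChartAt (cotModel E) p₀).map_target hy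
    have hr := (extChartAt (cotModel E) p₀).right_inv hy
    have h := tautological_tangentCoordChange hs hy1 V
    rw [← hd _ hs hy1, hr] at h
    exact h

/-! ### The metric and the energy density in a chart -/

variable (g)

theorem metricInChart_extChartAt {x z : M} (hz : z ∈ (extChartAt 𝓘(ℝ, E) x).source) (u v : E) :
    metricInChart g x (extChartAt 𝓘(ℝ, E) x z) u v =
      (show E →L[ℝ] E →L[ℝ] ℝ from g.inner z) (tangentCoordChange 𝓘(ℝ, E) x z z u)
        (tangentCoordChange 𝓘(ℝ, E) x z z v) := by
  have h := mfderivWithin_extChartAt_symm_eq_tangentCoordChange hz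
  rw [modelWithCornersSelf_coe, range_id, mfderivWithin_univ] at h
  unfold metricInChart
  rw [h, (extChartAt 𝓘(ℝ, E) x).left_inv hz]
  rfl

theorem metricInChart_extChartAt_self (x : M) (u v : E) :
    metricInChart g x (extChartAt 𝓘(ℝ, E) x x) u v =
      (show E →L[ℝ] E →L[ℝ] ℝ from g.inner x) u v := by
  rw [metricInChart_extChartAt g (mem_extChartAt_source x),
    tangentCoordChange_self (mem_extChartAt_source x),
    tangentCoordChange_self (mem_extChartAt_source x)]

theorem metricInChart_comm (x : M) (y u v : E) :
    metricInChart g x y u v = metricInChart g x y v u :=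
  g.symm ((extChartAt 𝓘(ℝ, E) x).symm y)
    (mfderiv 𝓘(ℝ, E) 𝓘(ℝ, E) (extChartAt 𝓘(ℝ, E) x).symm y u)
    (mfderiv 𝓘(ℝ, E) 𝓘(ℝ, E) (extChartAt 𝓘(ℝ, E) x).symm y v)

theorem symm_trivializationAt_tangent {x z : M} (hz : z ∈ (extChartAt 𝓘(ℝ, E) x).source) (u : E) :
    (trivializationAt E (TangentSpace 𝓘(ℝ, E)) x).symm z u =
      (show TangentSpace 𝓘(ℝ, E) z from tangentCoordChange 𝓘(ℝ, E) x z z u) := by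
  rw [extChartAt_source] at hz
  rw [← Trivialization.symmL_apply (R := ℝ) _ hz]
  exact congrArg (fun L : E →L[ℝ] E => L u)
    (TangentBundle.symmL_trivializationAt_eq_core (I := 𝓘(ℝ, E)) hz)

theorem inCoordinates_inner {x z : M} (hz : z ∈ (extChartAt 𝓘(ℝ, E) x).source) :
    ContinuousLinearMap.inCoordinates E (TangentSpace 𝓘(ℝ, E)) (E →L[ℝ] ℝ)
      (fun b : M => TangentSpace 𝓘(ℝ, E) b →L[ℝ] ℝ) x z x z (g.inner z) =
      metricInChart g x (extChartAt 𝓘(ℝ, E) x z) := by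
  have hb : z ∈ (trivializationAt E (TangentSpace 𝓘(ℝ, E)) x).baseSet := by
    rwa [extChartAt_source] at hz
  refine ContinuousLinearMap.ext fun u => ContinuousLinearMap.ext fun v => ?_
  rw [metricInChart_extChartAt g hz]
  refine (inCoordinates_apply_eq₂ (F₃ := ℝ) (E₃ := fun _ : M => ℝ) (ϕ := g.inner z) (v := u)
    (w := v) hb hb (mem_univ z)).trans ?_
  rw [symm_trivializationAt_tangent hz, symm_trivializationAt_tangent hz]
  simp only [Trivial.fiberBundle_trivializationAt', Trivial.linearMapAt_trivialization,
    LinearMap.id_coe, id_eq]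
  rfl

theorem contDiffAt_metricInChart (x : M) :
    ContDiffAt ℝ ∞ (metricInChart g x) (extChartAt 𝓘(ℝ, E) x x) := by
  have h1 := ((contMDiffAt_hom_bundle _).1 (g.contMDiff x)).2
  have h2 : ContMDiffAt 𝓘(ℝ, E) 𝓘(ℝ, E) ∞ (extChartAt 𝓘(ℝ, E) x).symm (extChartAt 𝓘(ℝ, E) x x) :=
    (contMDiffOn_extChartAt_symm x).contMDiffAt (extChartAt_target_mem_nhds x)
  have h3 := ContMDiffAt.comp_of_eq (y := x) h1 h2 (extChartAt_to_inv x)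
  refine h3.contDiffAt.congr_of_eventuallyEq ?_
  filter_upwards [extChartAt_target_mem_nhds (I := 𝓘(ℝ, E)) x] with y hy
  have h4 := inCoordinates_inner g ((extChartAt 𝓘(ℝ, E) x).map_target hy)
  rw [(extChartAt 𝓘(ℝ, E) x).right_inv hy] at h4
  exact h4.symm

theorem isInvertible_metricInChart {x z : M} (hz : z ∈ (extChartAt 𝓘(ℝ, E) x).source) :
    (metricInChart g x (extChartAt 𝓘(ℝ, E) x z)).IsInvertible := by
  have hinj : Function.Injective (metricInChart g x (extChartAt 𝓘(ℝ, E) x z)).toLinearMap := by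
    rw [← LinearMap.ker_eq_bot, LinearMap.ker_eq_bot']
    intro u hu
    by_contra hne
    have h0 : tangentCoordChange 𝓘(ℝ, E) x z z u ≠ 0 := by
      intro h
      have h2 := tangentCoordChange_comp (I := 𝓘(ℝ, E)) (w := x) (x := z) (y := x) (z := z) (v := u)
        ⟨⟨hz, mem_extChartAt_source z⟩, hz⟩
      rw [h, map_zero, tangentCoordChange_self hz] at h2
      exact hne h2.symm
    have h1 := g.pos z _ h0
    have h2 := metricInChart_extChartAt g hz u u
    have h3 := congrArg (fun L : E →L[ℝ] ℝ => L u) hu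
    exact h1.ne (h3.symm.trans h2)
  have hdim : Module.finrank ℝ E = Module.finrank ℝ (E →L[ℝ] ℝ) := by
    rw [← (LinearMap.toContinuousLinearMap : (E →ₗ[ℝ] ℝ) ≃ₗ[ℝ] (E →L[ℝ] ℝ)).finrank_eq]
    exact (Subspace.dual_finrank_eq (K := ℝ) (V := E)).symm
  exact ⟨(LinearMap.linearEquivOfInjective _ hinj hdim).toContinuousLinearEquiv,
    ContinuousLinearMap.ext fun _ => rfl⟩

/-- The vector `v` determined by `g_{ij}(q) v^j = ξ_i` in the chart around `x`: the local expression
of `p ↦ p^♯`. -/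
def sharpInChart (x : M) (y : E × (E →L[ℝ] ℝ)) : E := (metricInChart g x y.1).inverse y.2

/-- The energy density read in the preferred chart of `T^*M` around `p`. -/
def energyInChart (p : CotangentBundle E M) (y : E × (E →L[ℝ] ℝ)) : ℝ :=
  energy g ((extChartAt (cotModel E) p).symm y)

theorem metricInChart_sharpInChart {x z : M} (hz : z ∈ (extChartAt 𝓘(ℝ, E) x).source)
    (ξ : E →L[ℝ] ℝ) :
    metricInChart g x (extChartAt 𝓘(ℝ, E) x z) (sharpInChart g x (extChartAt 𝓘(ℝ, E) x z, ξ)) = ξ :=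
  (isInvertible_metricInChart g hz).self_apply_inverse ξ

theorem contDiffAt_sharpInChart (x : M) (ξ : E →L[ℝ] ℝ) :
    ContDiffAt ℝ ∞ (sharpInChart g x) (extChartAt 𝓘(ℝ, E) x x, ξ) := by
  have h1 : ContDiffAt ℝ ∞ (fun y : E × (E →L[ℝ] ℝ) => metricInChart g x y.1)
      (extChartAt 𝓘(ℝ, E) x x, ξ) :=
    ContDiffAt.comp (extChartAt 𝓘(ℝ, E) x x, ξ) (contDiffAt_metricInChart g x) contDiffAt_fst
  have h2 := (isInvertible_metricInChart g (mem_extChartAt_source x)).contDiffAt_map_inverse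
    (n := ∞)
  have h3 := ContDiffAt.comp (extChartAt 𝓘(ℝ, E) x x, ξ) h2 h1
  exact h3.clm_apply contDiffAt_snd

theorem energyInChart_extChartAt {p q : CotangentBundle E M}
    (hq : q ∈ (extChartAt (cotModel E) p).source) :
    energyInChart g p (extChartAt (cotModel E) p q) = energy g q := by
  rw [energyInChart, (extChartAt (cotModel E) p).left_inv hq]

theorem energyInChart_eq {p : CotangentBundle E M} {y : E × (E →L[ℝ] ℝ)}
    (hy : y ∈ (extChartAt (cotModel E) p).target) :
    energyInChart g p y = (1 / 2) * y.2 (sharpInChart g p.proj y) := by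
  obtain ⟨q, hq, rfl⟩ : ∃ q ∈ (extChartAt (cotModel E) p).source, extChartAt (cotModel E) p q = y :=
    ⟨_, (extChartAt (cotModel E) p).map_target hy, (extChartAt (cotModel E) p).right_inv hy⟩
  have hq' := mem_extChartAt_cotangent_source.1 hq
  rw [energyInChart_extChartAt g hq, extChartAt_cotangent p q hq', energy, cometric]
  congr 1
  set ξ : E →L[ℝ] ℝ := (show E →L[ℝ] ℝ from q.2).comp
    (tangentCoordChange 𝓘(ℝ, E) p.proj q.proj q.proj) with hξ
  set v := sharpInChart g p.proj (extChartAt 𝓘(ℝ, E) p.proj q.proj, ξ) with hv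
  have h1 := metricInChart_sharpInChart g hq' ξ
  rw [← hv] at h1
  have h2 : sharp g q.proj q.2 = tangentCoordChange 𝓘(ℝ, E) p.proj q.proj q.proj v := by
    refine (LinearEquiv.symm_apply_eq _).2 (ContinuousLinearMap.ext fun w => ?_)
    have h3 : tangentCoordChange 𝓘(ℝ, E) p.proj q.proj q.proj
        (tangentCoordChange 𝓘(ℝ, E) q.proj p.proj q.proj w) = w :=
      (tangentCoordChange_comp ⟨⟨mem_extChartAt_source _, hq'⟩, mem_extChartAt_source _⟩).trans
        (tangentCoordChange_self (mem_extChartAt_source _))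
    have h4 := metricInChart_extChartAt g hq' v
      (tangentCoordChange 𝓘(ℝ, E) q.proj p.proj q.proj w)
    rw [h1, h3, hξ, ContinuousLinearMap.comp_apply, h3] at h4
    exact h4
  rw [h2]
  rfl

theorem contDiffAt_energyInChart (p : CotangentBundle E M) :
    ContDiffAt ℝ ∞ (energyInChart g p) (extChartAt (cotModel E) p p) := by
  have h1 : ContDiffAt ℝ ∞ (sharpInChart g p.proj) (extChartAt (cotModel E) p p) := by
    rw [extChartAt_cotangent_self p]
    exact contDiffAt_sharpInChart g p.proj p.2
  have h2 : ContDiffAt ℝ ∞ (fun y : E × (E →L[ℝ] ℝ) => (1 / 2) * y.2 (sharpInChart g p.proj y))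
      (extChartAt (cotModel E) p p) := contDiffAt_const.mul (contDiffAt_snd.clm_apply h1)
  refine h2.congr_of_eventuallyEq ?_
  filter_upwards [extChartAt_target_mem_nhds (I := cotModel E) p] with y hy
  exact energyInChart_eq g hy


/-- Let `e(q, π) = ½ π(v) = ½ m_q(v, v)`, where `v = s(q, π)` is determined by `m_q(v, ·) = π`.
Differentiating both expressions eliminates the derivative of `v` and gives
`de(X, ζ) = ζ(v) - ½ (∂_X m)(v, v)`. -/
theorem fderiv_quadratic_energy {V : Type*} [NormedAddCommGroup V] [NormedSpace ℝ V]
    {m : V → V →L[ℝ] V →L[ℝ] ℝ} {s : V × (V →L[ℝ] ℝ) → V} {e : V × (V →L[ℝ] ℝ) → ℝ}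
    {y₀ : V × (V →L[ℝ] ℝ)} (hm : DifferentiableAt ℝ m y₀.1) (hs : DifferentiableAt ℝ s y₀)
    (hsymm : ∀ u v, m y₀.1 u v = m y₀.1 v u) (hms : ∀ᶠ y in 𝓝 y₀, m y.1 (s y) = y.2)
    (he : ∀ᶠ y in 𝓝 y₀, e y = (1 / 2) * y.2 (s y)) (X : V) (ζ : V →L[ℝ] ℝ) :
    fderiv ℝ e y₀ (X, ζ) = ζ (s y₀) - (1 / 2) * fderiv ℝ m y₀.1 X (s y₀) (s y₀) := by
  have hm₀ := hm.hasFDerivAt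
  have hfst := hasFDerivAt_fst (𝕜 := ℝ) (p := y₀)
  have hm' := HasFDerivAt.comp (g := m) (f := Prod.fst) y₀ hm₀ hfst
  have h1 := ((hasFDerivAt_snd (𝕜 := ℝ) (p := y₀)).clm_apply hs.hasFDerivAt).const_mul (1 / 2)
  have h2 := ((hm'.clm_apply hs.hasFDerivAt).clm_apply hs.hasFDerivAt).const_mul (1 / 2)
  have hms₀ := hms.self_of_nhds
  have he' : e =ᶠ[𝓝 y₀] fun y => (1 / 2) * m y.1 (s y) (s y) := by
    filter_upwards [hms, he] with y h h'
    rw [h, h']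
  have d1 : fderiv ℝ e y₀ (X, ζ) = (1 / 2) * (y₀.2 (fderiv ℝ s y₀ (X, ζ)) + ζ (s y₀)) := by
    rw [(h1.congr_of_eventuallyEq he).fderiv]
    simp
    ring
  have d2 : fderiv ℝ e y₀ (X, ζ) = (1 / 2) * (y₀.2 (fderiv ℝ s y₀ (X, ζ))
      + (y₀.2 (fderiv ℝ s y₀ (X, ζ)) + fderiv ℝ m y₀.1 X (s y₀) (s y₀))) := by
    rw [(h2.congr_of_eventuallyEq he').fderiv]
    simp only [smul_apply, add_apply, ContinuousLinearMap.comp_apply,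
      ContinuousLinearMap.flip_apply, ContinuousLinearMap.coe_fst', smul_eq_mul,
      Function.comp_apply]
    rw [hsymm _ (s y₀), hms₀]
  linarith

theorem sharpInChart_extChartAt (x : M) (ξ : E →L[ℝ] ℝ) :
    sharpInChart g x (extChartAt 𝓘(ℝ, E) x x, ξ) = sharp g x ξ := by
  refine ((LinearEquiv.symm_apply_eq (flat g x)).2 (ContinuousLinearMap.ext fun w => ?_)).symm
  have h1 := metricInChart_extChartAt_self g x
    (sharpInChart g x (extChartAt 𝓘(ℝ, E) x x, ξ)) w
  rw [metricInChart_sharpInChart g (mem_extChartAt_source x) ξ] at h1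
  exact h1

theorem sharpInChart_self (p : CotangentBundle E M) :
    sharpInChart g p.proj (extChartAt (cotModel E) p p) = sharp g p.proj p.2 := by
  rw [extChartAt_cotangent_self]
  exact sharpInChart_extChartAt g p.proj p.2

theorem metricDeriv_comm (x : M) (w u v : E) : metricDeriv g x w u v = metricDeriv g x w v u := by
  have hd := ((contDiffAt_metricInChart g x).differentiableAt (by simp)).hasFDerivAt
  have h1 := (hd.clm_apply (hasFDerivAt_const u _)).clm_apply (hasFDerivAt_const v _)
  have h2 := (hd.clm_apply (hasFDerivAt_const v _)).clm_apply (hasFDerivAt_const u _)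
  have h3 := h1.unique (h2.congr_of_eventuallyEq
    (.of_forall fun y => metricInChart_comm g x y u v))
  have h4 := congrArg (fun L : E →L[ℝ] ℝ => L w) h3
  simp only [ContinuousLinearMap.flip_apply, add_apply, ContinuousLinearMap.comp_apply,
    zero_apply, map_zero, zero_add] at h4
  exact h4

theorem christoffelCovector_comm (p : CotangentBundle E M) (u v : E) :
    christoffelCovector g p u v = christoffelCovector g p v u := by
  have h : christoffelFirst g p.proj u v = christoffelFirst g p.proj v u := by
    ext w
    change (1 / 2) * (metricDeriv g p.proj u v w + metricDeriv g p.proj v u w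
      - metricDeriv g p.proj w u v) = (1 / 2) * (metricDeriv g p.proj v u w
        + metricDeriv g p.proj u v w - metricDeriv g p.proj w v u)
    rw [metricDeriv_comm g p.proj w u v]
    ring
  exact congrArg (fun f : E →ₗ[ℝ] ℝ =>
    p.2 (sharp g p.proj (show E →L[ℝ] ℝ from LinearMap.toContinuousLinearMap f))) h

/-- Lowering the index, `p(Γ(u, v)) = g(p^♯, Γ(u, v))`. -/
theorem christoffelCovector_apply (p : CotangentBundle E M) (u v : E) :
    christoffelCovector g p u v = christoffelFirst g p.proj u v (sharp g p.proj p.2) := by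
  exact cometric_comm g p.proj p.2
    (show E →L[ℝ] ℝ from LinearMap.toContinuousLinearMap (christoffelFirst g p.proj u v))

/-- The differential of the energy density annihilates the horizontal lifts, because the
Levi-Civita connection is metric, and is `g⁻¹(p, ·)` on the vertical ones. -/
theorem fderiv_energyInChart (p : CotangentBundle E M) (Z : E × (E →L[ℝ] ℝ)) :
    fderiv ℝ (energyInChart g p) (extChartAt (cotModel E) p p) Z =
      cometric g p.proj p.2 (verticalPart g p Z) := by
  obtain ⟨X, ζ⟩ := Z
  have h0 := extChartAt_cotangent_self p
  have hm : DifferentiableAt ℝ (metricInChart g p.proj) (extChartAt (cotModel E) p p).1 := by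
    rw [h0]
    exact (contDiffAt_metricInChart g p.proj).differentiableAt (by simp)
  have hs : DifferentiableAt ℝ (sharpInChart g p.proj) (extChartAt (cotModel E) p p) := by
    rw [h0]
    exact (contDiffAt_sharpInChart g p.proj p.2).differentiableAt (by simp)
  rw [fderiv_quadratic_energy hm hs (metricInChart_comm g p.proj _) ?_ ?_ X ζ]
  · have h1 : cometric g p.proj p.2 (verticalPart g p (X, ζ)) =
        ζ (sharp g p.proj p.2) - christoffelCovector g p X (sharp g p.proj p.2) := by
      rw [cometric_comm]
      rfl
    have h2 : christoffelFirst g p.proj X (sharp g p.proj p.2) (sharp g p.proj p.2) =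
        (1 / 2) * metricDeriv g p.proj X (sharp g p.proj p.2) (sharp g p.proj p.2) := by
      change (1 / 2) * (metricDeriv g p.proj X (sharp g p.proj p.2) (sharp g p.proj p.2)
        + metricDeriv g p.proj (sharp g p.proj p.2) X (sharp g p.proj p.2)
        - metricDeriv g p.proj (sharp g p.proj p.2) X (sharp g p.proj p.2)) = _
      ring
    have h3 := christoffelCovector_apply g p X (sharp g p.proj p.2)
    have h4 : fderiv ℝ (metricInChart g p.proj) (extChartAt (cotModel E) p p).1 X
        (sharp g p.proj p.2) (sharp g p.proj p.2) =
        metricDeriv g p.proj X (sharp g p.proj p.2) (sharp g p.proj p.2) := by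
      rw [h0]
      rfl
    rw [sharpInChart_self, h4]
    linarith
  · filter_upwards [extChartAt_target_mem_nhds (I := cotModel E) p] with y hy
    obtain ⟨q, hq, rfl⟩ : ∃ q ∈ (extChartAt (cotModel E) p).source,
        extChartAt (cotModel E) p q = y :=
      ⟨_, (extChartAt (cotModel E) p).map_target hy, (extChartAt (cotModel E) p).right_inv hy⟩
    have hq' := mem_extChartAt_cotangent_source.1 hq
    rw [extChartAt_cotangent p q hq']
    exact metricInChart_sharpInChart g hq' _
  · filter_upwards [extChartAt_target_mem_nhds (I := cotModel E) p] with y hy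
    exact energyInChart_eq g hy

/-- Because the Levi-Civita connection is torsion-free, the canonical symplectic form pairs the
horizontal and the vertical components. -/
theorem symplectic_eq_splitting (p : CotangentBundle E M) (Z W : TangentSpace (cotModel E) p) :
    verticalPart g p W (horizontalPart p Z) - verticalPart g p Z (horizontalPart p W) =
      tautological E W Z - tautological E Z W := by
  have h := christoffelCovector_comm g p (Z : E × (E →L[ℝ] ℝ)).1 (W : E × (E →L[ℝ] ℝ)).1
  change ((W : E × (E →L[ℝ] ℝ)).2 (Z : E × (E →L[ℝ] ℝ)).1
      - christoffelCovector g p (W : E × (E →L[ℝ] ℝ)).1 (Z : E × (E →L[ℝ] ℝ)).1)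
    - ((Z : E × (E →L[ℝ] ℝ)).2 (W : E × (E →L[ℝ] ℝ)).1
      - christoffelCovector g p (Z : E × (E →L[ℝ] ℝ)).1 (W : E × (E →L[ℝ] ℝ)).1) =
    (W : E × (E →L[ℝ] ℝ)).2 (Z : E × (E →L[ℝ] ℝ)).1
      - (Z : E × (E →L[ℝ] ℝ)).2 (W : E × (E →L[ℝ] ℝ)).1
  linarith

/-! ### The exterior derivative of `λ(t) ω + μ(t) θ ∧ dt` -/

section ModelForm

variable {V : Type*} [NormedAddCommGroup V] [NormedSpace ℝ V]

/-- The antisymmetrization of a bilinear form `B`, as the `2`-form `(Z, W) ↦ B(Z, W) - B(W, Z)`. -/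
def antisymmForm (V : Type*) [NormedAddCommGroup V] [NormedSpace ℝ V] :
    (V →L[ℝ] V →L[ℝ] ℝ) →L[ℝ] V [⋀^Fin 2]→L[ℝ] ℝ :=
  (ContinuousAlternatingMap.alternatizeUncurryFinCLM ℝ V ℝ).comp
    (ContinuousLinearMap.compL ℝ V (V →L[ℝ] ℝ) (V [⋀^Fin 1]→L[ℝ] ℝ)
      (ContinuousAlternatingMap.ofSubsingletonLIE (𝕜 := ℝ) (E := V) (F := ℝ)
        (0 : Fin 1)).toContinuousLinearEquiv)

theorem antisymmForm_apply (B : V →L[ℝ] V →L[ℝ] ℝ) (v : Fin 2 → V) :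
    antisymmForm V B v = B (v 0) (v 1) - B (v 1) (v 0) := by
  have h := ContinuousAlternatingMap.alternatizeUncurryFin_apply (v := v)
    (ContinuousLinearMap.compL ℝ V (V →L[ℝ] ℝ) (V [⋀^Fin 1]→L[ℝ] ℝ)
      (ContinuousAlternatingMap.ofSubsingletonLIE (𝕜 := ℝ) (E := V) (F := ℝ)
        (0 : Fin 1)).toContinuousLinearEquiv B)
  refine h.trans ?_
  simp [Fin.sum_univ_two, Fin.removeNth, sub_eq_add_neg]

/-- The wedge product `(α ∧ γ)(Z, W) = α(Z) γ(W) - α(W) γ(Z)` of `1`-forms, as a continuous bilinear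
map. -/
def wedge (V : Type*) [NormedAddCommGroup V] [NormedSpace ℝ V] :
    (V →L[ℝ] ℝ) →L[ℝ] (V →L[ℝ] ℝ) →L[ℝ] V [⋀^Fin 2]→L[ℝ] ℝ :=
  (ContinuousLinearMap.compL ℝ (V →L[ℝ] ℝ) (V →L[ℝ] V →L[ℝ] ℝ) (V [⋀^Fin 2]→L[ℝ] ℝ)
    (antisymmForm V)).comp (ContinuousLinearMap.smulRightL ℝ V (V →L[ℝ] ℝ))

theorem wedge_apply (α γ : V →L[ℝ] ℝ) (v : Fin 2 → V) :
    wedge V α γ v = α (v 0) * γ (v 1) - α (v 1) * γ (v 0) :=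
  antisymmForm_apply (α.smulRight γ) v

/-- The `2`-form `λ(e) ω + μ(e) θ ∧ de`, where `θ_y = β y` and
`ω(Z, W) = β W Z - β Z W = -dθ(Z, W)`. -/
def modelForm (β : V →L[ℝ] V →L[ℝ] ℝ) (e : V → ℝ) (l m : ℝ → ℝ) (y : V) : V [⋀^Fin 2]→L[ℝ] ℝ :=
  m (e y) • wedge V (β y) (fderiv ℝ e y) - l (e y) • antisymmForm V β

theorem modelForm_apply (β : V →L[ℝ] V →L[ℝ] ℝ) (e : V → ℝ) (l m : ℝ → ℝ) (y : V)
    (v : Fin 2 → V) :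
    modelForm β e l m y v = l (e y) * (β (v 1) (v 0) - β (v 0) (v 1))
      + m (e y) * (β y (v 0) * fderiv ℝ e y (v 1) - β y (v 1) * fderiv ℝ e y (v 0)) := by
  change m (e y) * wedge V (β y) (fderiv ℝ e y) v - l (e y) * antisymmForm V β v = _
  rw [wedge_apply, antisymmForm_apply]
  ring

/-- `d(λ ω + μ θ ∧ de) = (λ' - μ) de ∧ ω`, since `dθ = -ω`, `dω = 0` and `d(de) = 0`. -/
theorem extDeriv_modelForm (β : V →L[ℝ] V →L[ℝ] ℝ) {e : V → ℝ} {l m : ℝ → ℝ} {y : V} {l' m' : ℝ}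
    (he : ContDiffAt ℝ 2 e y) (hl : HasFDerivAt (fun y => l (e y)) (l' • fderiv ℝ e y) y)
    (hm : HasFDerivAt (fun y => m (e y)) (m' • fderiv ℝ e y) y) (v : Fin 3 → V) :
    extDeriv (modelForm β e l m) y v = (l' - m (e y)) *
      (fderiv ℝ e y (v 0) * (β (v 2) (v 1) - β (v 1) (v 2))
        - fderiv ℝ e y (v 1) * (β (v 2) (v 0) - β (v 0) (v 2))
        + fderiv ℝ e y (v 2) * (β (v 1) (v 0) - β (v 0) (v 1))) := by
  have hβ := β.hasFDerivAt (x := y)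
  have he' : HasFDerivAt (fderiv ℝ e) (fderiv ℝ (fderiv ℝ e) y) y :=
    ((he.fderiv_right (m := 1) (by norm_num)).differentiableAt (by norm_num)).hasFDerivAt
  have h1 := (wedge V).hasFDerivAt_of_bilinear hβ he'
  have h2 := (hm.smul h1).sub (hl.smul (hasFDerivAt_const (antisymmForm V β) y))
  have hs := he.isSymmSndFDerivAt (by simp)
  have h3 : ∀ (U : V) (w : Fin 2 → V), fderiv ℝ (modelForm β e l m) y U w =
      m (e y) * ((β y (w 0) * fderiv ℝ (fderiv ℝ e) y U (w 1)
          - β y (w 1) * fderiv ℝ (fderiv ℝ e) y U (w 0))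
        + (β U (w 0) * fderiv ℝ e y (w 1) - β U (w 1) * fderiv ℝ e y (w 0)))
      + m' * fderiv ℝ e y U * (β y (w 0) * fderiv ℝ e y (w 1) - β y (w 1) * fderiv ℝ e y (w 0))
      - l' * fderiv ℝ e y U * (β (w 0) (w 1) - β (w 1) (w 0)) := by
    intro U w
    rw [← wedge_apply, ← wedge_apply, ← wedge_apply, ← antisymmForm_apply]
    have h4 := congrArg (fun L : V →L[ℝ] V [⋀^Fin 2]→L[ℝ] ℝ => L U w) h2.fderiv
    refine h4.trans ?_
    simp
    ring
  rw [extDeriv, ContinuousAlternatingMap.alternatizeUncurryFin_apply]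
  refine (Fin.sum_univ_three _).trans ?_
  simp only [h3]
  simp [Fin.removeNth, Fin.succAbove]
  rw [hs (v 1) (v 0), hs (v 2) (v 0), hs (v 2) (v 1)]
  ring

end ModelForm

/-- The chain rule for an outer function that is differentiable only on `[0, ∞)`; where `e y = 0`
its one-sided derivative takes the place of the derivative. -/
theorem hasFDerivAt_comp_of_mapsTo_Ici {V : Type*} [NormedAddCommGroup V] [NormedSpace ℝ V]
    {f : ℝ → ℝ} (hf : DifferentiableOn ℝ f (Ici 0)) {e : V → ℝ} (he0 : ∀ y, 0 ≤ e y) {y : V}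
    (he : DifferentiableAt ℝ e y) :
    HasFDerivAt (fun y => f (e y)) (derivWithin f (Ici 0) (e y) • fderiv ℝ e y) y := by
  have h1 := (hf (e y) (he0 y)).hasDerivWithinAt
  have h2 := h1.comp_hasFDerivWithinAt y (he.hasFDerivAt.hasFDerivWithinAt (s := univ))
    (fun z _ => he0 z)
  exact hasFDerivWithinAt_univ.1 h2

/-! ### The fundamental form in a chart and its exterior derivative -/

variable {g}

/-- In every chart of `T^*M`, `Ω = λ(t) ω + μ(t) θ ∧ dt`. -/
theorem formInChart_fundamentalForm {C : MetricCoeffs} {A : TensorCoeffs}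
    (h : IsAlmostParaHermitian (diagMetric g C) (diagTensor g A)) {l m : ℝ → ℝ}
    (hlm : IsProportionality C A l m) (hrel : ∀ t, 0 ≤ t → CoeffRelations C A t)
    (p : CotangentBundle E M) {y : E × (E →L[ℝ] ℝ)} (hy : y ∈ (extChartAt (cotModel E) p).target) :
    formInChart (cotModel E) (fundamentalForm h) p y =
      modelForm (tautological E) (energyInChart g p) l m y := by
  obtain ⟨q, hq, rfl⟩ : ∃ q ∈ (extChartAt (cotModel E) p).source, extChartAt (cotModel E) p q = y :=
    ⟨_, (extChartAt (cotModel E) p).map_target hy, (extChartAt (cotModel E) p).right_inv hy⟩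
  have hqq := mem_extChartAt_source (I := cotModel E) q
  have hΨ := hasFDerivAt_tangentCoordChange (I := cotModel E) hq hqq
  have hde : fderiv ℝ (energyInChart g p) (extChartAt (cotModel E) p q) =
      (fderiv ℝ (energyInChart g q) (extChartAt (cotModel E) q q)).comp
        (tangentCoordChange (cotModel E) p q q) := by
    have h1 : HasFDerivAt (energyInChart g q)
        (fderiv ℝ (energyInChart g q) (extChartAt (cotModel E) q q))
        ((extChartAt (cotModel E) q ∘ (extChartAt (cotModel E) p).symm)
          (extChartAt (cotModel E) p q)) := by
      rw [Function.comp_apply, (extChartAt (cotModel E) p).left_inv hq]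
      exact ((contDiffAt_energyInChart g q).differentiableAt (by simp)).hasFDerivAt
    refine ((h1.comp _ hΨ).congr_of_eventuallyEq ?_).fderiv
    have hc := continuousAt_extChartAt_symm' (I := cotModel E) hq
    have hn : (extChartAt (cotModel E) q).source ∈
        𝓝 ((extChartAt (cotModel E) p).symm (extChartAt (cotModel E) p q)) := by
      rw [(extChartAt (cotModel E) p).left_inv hq]
      exact extChartAt_source_mem_nhds q
    filter_upwards [hc.preimage_mem_nhds hn] with z hz
    exact (energyInChart_extChartAt g hz).symm
  ext v
  set T := tangentCoordChange (cotModel E) p q q with hT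
  have hsymp := (symplectic_eq_splitting g q (T (v 0)) (T (v 1))).trans
    (symplectic_tangentCoordChange hq hqq (v 0) (v 1))
  have hθ : ∀ Z, q.2 (horizontalPart q (T Z)) =
      tautological E (extChartAt (cotModel E) p q) Z := by
    intro Z
    rw [← tautological_tangentCoordChange hq hqq, extChartAt_cotangent_self q]
    rfl
  have hdt : ∀ Z, cometric g q.proj q.2 (verticalPart g q (T Z)) =
      fderiv ℝ (energyInChart g p) (extChartAt (cotModel E) p q) Z := by
    intro Z
    rw [hde, ← fderiv_energyInChart g q]
    rfl
  refine (formInChart_extChartAt _ hq v).trans ?_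
  refine (fundamentalForm_eq_splitting h hlm q (hrel _ (energy_nonneg g q)) _).trans ?_
  rw [modelForm_apply, energyInChart_extChartAt g hq, ← hsymp, ← hθ, ← hθ, ← hdt, ← hdt]

/-- `dΩ = (λ' - μ) dt ∧ ω` on `T^*M`. -/
theorem extDerivManifold_fundamentalForm {C : MetricCoeffs} {A : TensorCoeffs}
    (h : IsAlmostParaHermitian (diagMetric g C) (diagTensor g A)) {l m : ℝ → ℝ}
    (hlm : IsProportionality C A l m) (hrel : ∀ t, 0 ≤ t → CoeffRelations C A t)
    (p : CotangentBundle E M) (v : Fin 3 → E × (E →L[ℝ] ℝ)) :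
    extDerivManifold (cotModel E) (fundamentalForm h) p v =
      (derivWithin l (Ici 0) (energy g p) - m (energy g p)) *
      (cometric g p.proj p.2 (verticalPart g p (v 0))
          * (tautological E (v 2) (v 1) - tautological E (v 1) (v 2))
        - cometric g p.proj p.2 (verticalPart g p (v 1))
          * (tautological E (v 2) (v 0) - tautological E (v 0) (v 2))
        + cometric g p.proj p.2 (verticalPart g p (v 2))
          * (tautological E (v 1) (v 0) - tautological E (v 0) (v 1))) := by
  have h1 : formInChart (cotModel E) (fundamentalForm h) p =ᶠ[𝓝 (extChartAt (cotModel E) p p)]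
      modelForm (tautological E) (energyInChart g p) l m := by
    filter_upwards [extChartAt_target_mem_nhds (I := cotModel E) p] with y hy
    exact formInChart_fundamentalForm h hlm hrel p hy
  have he := contDiffAt_energyInChart g p
  have hd := he.differentiableAt (by simp)
  have he0 : ∀ y, 0 ≤ energyInChart g p y := fun y => energy_nonneg g _
  have h2 := extDeriv_modelForm (tautological E) (he.of_le ENat.LEInfty.out)
    (hasFDerivAt_comp_of_mapsTo_Ici (hlm.smooth_l.differentiableOn (by simp)) he0 hd)
    (hasFDerivAt_comp_of_mapsTo_Ici (hlm.smooth_m.differentiableOn (by simp)) he0 hd) v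
  rw [energyInChart_extChartAt g (mem_extChartAt_source p), fderiv_energyInChart,
    fderiv_energyInChart, fderiv_energyInChart] at h2
  rw [← h2, ← h1.extDeriv_eq, ← extDerivWithin_univ, ← (cotModel E).range_eq_univ]
  rfl

/-- `dt ∧ ω` does not vanish at a nonzero covector, when `M` has dimension at least two: evaluate it
on `p^V`, a horizontal lift and a vertical lift of a covector orthogonal to `p`. -/
theorem eq_derivWithin_of_extDerivManifold_eq_zero (hdim : 2 ≤ Module.finrank ℝ E)
    {C : MetricCoeffs} {A : TensorCoeffs}
    (h : IsAlmostParaHermitian (diagMetric g C) (diagTensor g A)) {l m : ℝ → ℝ}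
    (hlm : IsProportionality C A l m) (hrel : ∀ t, 0 ≤ t → CoeffRelations C A t)
    {p : CotangentBundle E M} (hp : 0 < energy g p)
    (hclosed : extDerivManifold (cotModel E) (fundamentalForm h) p = 0) :
    m (energy g p) = derivWithin l (Ici 0) (energy g p) := by
  obtain ⟨β, hβ, hpβ⟩ := exists_cometric_eq_zero g hdim p.proj p.2
  have hββ := cometric_pos g p.proj hβ
  have h1 := extDerivManifold_fundamentalForm h hlm hrel p
    ![verticalLift p p.2, horizontalLift g p (sharp g p.proj β), verticalLift p β]
  rw [hclosed] at h1
  change (0 : ℝ) = (derivWithin l (Ici 0) (energy g p) - m (energy g p)) *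
      (cometric g p.proj p.2 (verticalPart g p (verticalLift p p.2))
          * (tautological E (verticalLift p β) (horizontalLift g p (sharp g p.proj β))
            - tautological E (horizontalLift g p (sharp g p.proj β)) (verticalLift p β))
        - cometric g p.proj p.2 (verticalPart g p (horizontalLift g p (sharp g p.proj β)))
          * (tautological E (verticalLift p β) (verticalLift p p.2)
            - tautological E (verticalLift p p.2) (verticalLift p β))
        + cometric g p.proj p.2 (verticalPart g p (verticalLift p β))
          * (tautological E (horizontalLift g p (sharp g p.proj β)) (verticalLift p p.2)
            - tautological E (verticalLift p p.2) (horizontalLift g p (sharp g p.proj β)))) at h1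
  have h0 : cometric g p.proj p.2 0 = 0 := by simp [cometric]
  rw [← symplectic_eq_splitting g p, verticalPart_verticalLift, verticalPart_verticalLift,
    verticalPart_horizontalLift, h0, hpβ, horizontalPart_horizontalLift, cometric_self] at h1
  simp only [zero_mul, sub_zero, add_zero, zero_apply] at h1
  have h2 : 2 * energy g p * β (sharp g p.proj β) ≠ 0 :=
    mul_ne_zero (mul_ne_zero two_ne_zero hp.ne') hββ.ne'
  have h3 := (mul_eq_zero.1 h1.symm).resolve_right h2
  linarith

end NaturalDiagonal

end

theorem theorem5p1 {E : Type*} [NormedAddCommGroup E] [NormedSpace ℝ E] [FiniteDimensional ℝ E]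
    {M : Type*} [TopologicalSpace M] [ChartedSpace E M] [IsManifold 𝓘(ℝ, E) ∞ M] [Nonempty M]
    (hdim : 2 ≤ Module.finrank ℝ E)
    (g : ContMDiffRiemannianMetric 𝓘(ℝ, E) ∞ E (fun x : M => TangentSpace 𝓘(ℝ, E) x))
    (C : NaturalDiagonal.MetricCoeffs) (A : NaturalDiagonal.TensorCoeffs)
    (h : NaturalDiagonal.IsAlmostParaHermitian
      (NaturalDiagonal.diagMetric g C) (NaturalDiagonal.diagTensor g A)) :
    (∃ l m : ℝ → ℝ, NaturalDiagonal.IsProportionality C A l m) ∧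
    ∀ l m : ℝ → ℝ, NaturalDiagonal.IsProportionality C A l m →
      ((∀ p : NaturalDiagonal.CotangentBundle E M,
          NaturalDiagonal.extDerivManifold (NaturalDiagonal.cotModel E)
            (NaturalDiagonal.fundamentalForm h) p = 0) ↔
        ∀ t : ℝ, 0 ≤ t → m t = derivWithin l (Ici 0) t) := by
  have hrel : ∀ t, 0 ≤ t → NaturalDiagonal.CoeffRelations C A t :=
    fun t ht => h.coeffRelations hdim ht
  refine ⟨NaturalDiagonal.exists_isProportionality hrel,
    fun l m hlm => ⟨fun hclosed => ?_, fun hml p => ?_⟩⟩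
  · have hpos : EqOn m (derivWithin l (Ici 0)) (Ioi 0) := by
      intro t ht
      obtain ⟨p, rfl⟩ := NaturalDiagonal.exists_energy_eq g hdim (le_of_lt ht)
      exact NaturalDiagonal.eq_derivWithin_of_extDerivManifold_eq_zero
        hdim h hlm hrel ht (hclosed p)
    -- at `t = 0` the form `dt` vanishes, and the equality follows by continuity
    have hl' : ContinuousOn (derivWithin l (Ici 0)) (Ici 0) :=
      hlm.smooth_l.continuousOn_derivWithin (uniqueDiffOn_Ici 0) (by simp)
    have hcl := hpos.of_subset_closure hlm.smooth_m.continuousOn hl' Ioi_subset_Ici_self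
      (by rw [closure_Ioi])
    exact fun t ht => hcl ht
  · refine ContinuousAlternatingMap.ext fun v => ?_
    refine (NaturalDiagonal.extDerivManifold_fundamentalForm h hlm hrel p v).trans ?_
    rw [hml _ (NaturalDiagonal.energy_nonneg g p), sub_self, zero_mul]
    rfl
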